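/- There is an oracle $O\subseteq\{0,1\}^*$ relative to which the following three statements hold: (1) $\mathrm{P}^O\neq\mathrm{NP}^O$; (2) every non-empty set $A\in\mathrm{NP}^O\cup\mathrm{coNP}^O$ has a $\mathrm{P}^O$-optimal proof system; (3) neither $\mathsf{CON}^O$ nor $\mathsf{SAT}^O$ holds, that is, some $\le_m^{p,O}$-complete set of $\mathrm{coNP}^O$ and some $\le_m^{p,O}$-complete set of $\mathrm{NP}^O$ have $\mathrm{P}^O$-optimal proof systems. (Consequently, $\mathrm{P}\neq\mathrm{NP}$ does not relativizably imply $\mathsf{CON}\vee\mathsf{SAT}$.) Here $\mathrm{P}^O$ and $\mathrm{NP}^O$ are the classes of languages $L\subseteq\{0,1\}^*$ accepted with oracle $O$ by deterministic, respectively nondeterministic, polynomial-time oracle Turing machines, $\mathrm{coNP}^O$ consists of the complements of the sets in $\mathrm{NP}^O$, and $\mathrm{FP}^O$ is the class of total functions $\{0,1\}^*\to\{0,1\}^*$ computed with oracle $O$ by deterministic polynomial-time oracle Turing transducers. A function $g\in\mathrm{FP}^O$ is a $\mathrm{P}^O$-optimal proof system for $A$ if $g$ has range $A$ and for every $f\in\mathrm{FP}^O$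 with range $A$ there are $\pi\in\mathrm{FP}^O$ and a polynomial $p$ with $|\pi(x)|\le p(|x|)$ and $g(\pi(x))=f(x)$ for all $x\in\{0,1\}^*$. Moreover, $B\le_m^{p,O}A$ means that there is $r\in\mathrm{FP}^O$ with $x\in B\Leftrightarrow r(x)\in A$ for all $x$. $\mathsf{CON}^O$ (respectively $\mathsf{SAT}^O$) is the assertion that no $\le_m^{p,O}$-complete set of $\mathrm{coNP}^O$ (respectively $\mathrm{NP}^O$) has a $\mathrm{P}^O$-optimal proof system. -/

import Mathlib

namespace OracleTM

/-- Words over the alphabet `{0, 1}`. -/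
abbrev Word : Type := List Bool

/-- The instruction executed in an ordinary (non-query) step of a machine with tapes indexed by `K`
and states in `Q`: the next state, the symbol written on each tape (`none` is the blank), the head
movement on each tape (`none` means: stay), and optionally a bit to append to the write-only query
tape and a bit to append to the write-only output tape. -/
structure Action (K Q : Type) where
  next : Q
  write : K → Option Bool
  move : K → Option Turing.Dir
  query : Option Bool
  output : Option Bool

/-- A nondeterministic multi-tape oracle Turing machine (with a write-only query tape and a
write-only output tape) with read-write tapes indexed by `K`, states in `Q` and tape alphabet
`{0, 1, blank}`. A state `q` with `ask q = some (y, n)` is a query state with answer states `y`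
(yes) and `n` (no). In all other states `trans` gives the set of the possible instructions, as a
function of the state and of the scanned symbols. -/
structure Machine (K Q : Type) where
  start : Q
  accept : Set Q
  inputTape : K
  ask : Q → Option (Q × Q)
  trans : Q → (K → Option Bool) → Set (Action K Q)

/-- Configurations: the state, the read-write tapes with their heads, and the words written so far
on the query tape (since the last query) and on the output tape. -/
structure Cfg (K Q : Type) where
  state : Q
  tape : K → Turing.Tape (Option Bool)
  query : Word
  output : Word

/-- The configuration that results from executing an ordinary instruction. -/
def Cfg.apply {K Q : Type} (c : Cfg K Q) (a : Action K Q) : Cfg K Q where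
  state := a.next
  tape := fun i =>
    match a.move i with
    | none => (c.tape i).write (a.write i)
    | some d => ((c.tape i).write (a.write i)).move d
  query := c.query ++ a.query.toList
  output := c.output ++ a.output.toList

namespace Machine

variable {K Q : Type}

open Classical in
/-- The start configuration on input `x`: the input tape holds `x`, with its head on the first
letter of `x`, and all the other tapes are blank. -/
noncomputable def init (M : Machine K Q) (x : Word) : Cfg K Q where
  state := M.start
  tape := fun i => if i = M.inputTape then Turing.Tape.mk₁ (x.map some) else default
  query := []
  output := []

/-- `c'` is a successor of the configuration `c` with oracle `D`. In a query state the word on the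
query tape is submitted to the oracle, the answer determines the next state, and the query tape is
erased. -/
def Step (M : Machine K Q) (D : Set Word) (c c' : Cfg K Q) : Prop :=
  match M.ask c.state with
  | some (y, n) =>
      (c.query ∈ D ∧ c' = { c with state := y, query := [] }) ∨
      (c.query ∉ D ∧ c' = { c with state := n, query := [] })
  | none => ∃ a ∈ M.trans c.state (fun i => (c.tape i).head), c' = c.apply a

/-- `M.Steps D t c c'`: with oracle `D`, some computation path leads from `c` to `c'` in exactly
`t` steps. -/
inductive Steps (M : Machine K Q) (D : Set Word) : ℕ → Cfg K Q → Cfg K Q → Prop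
  | zero (c : Cfg K Q) : Steps M D 0 c c
  | succ {t : ℕ} {a b c : Cfg K Q} : Steps M D t a b → M.Step D b c → Steps M D (t + 1) a c

/-- A configuration is halting if it has no successor. -/
def Halted (M : Machine K Q) (D : Set Word) (c : Cfg K Q) : Prop :=
  ∀ c', ¬ M.Step D c c'

/-- At most one instruction is available in every situation. -/
def Deterministic (M : Machine K Q) : Prop :=
  ∀ q s, (M.trans q s).Subsingleton

/-- Polynomial-time oracle machines: the length of every computation path, on every input and with
every oracle, is bounded by a fixed polynomial in the length of the input. -/
def PolyTime (M : Machine K Q) : Prop :=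
  ∃ p : Polynomial ℕ, ∀ (D : Set Word) (x : Word) (t : ℕ) (c : Cfg K Q),
    M.Steps D t (M.init x) c → t ≤ p.eval x.length

/-- The language `L(M^D)`: the words on which some computation path halts in an accepting
state. -/
def language (M : Machine K Q) (D : Set Word) : Set Word :=
  {x | ∃ t c, M.Steps D t (M.init x) c ∧ M.Halted D c ∧ c.state ∈ M.accept}

/-- On every input `x` the machine halts with output `f x`, with oracle `D` (used for deterministic
machines). -/
def Computes (M : Machine K Q) (D : Set Word) (f : Word → Word) : Prop :=
  ∀ x, ∃ t c, M.Steps D t (M.init x) c ∧ M.Halted D c ∧ c.output = f x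

end Machine

/-- The class `P^O`. -/
def classP (O : Set Word) : Set (Set Word) :=
  {L | ∃ (k n : ℕ) (M : Machine (Fin k) (Fin n)),
    M.Deterministic ∧ M.PolyTime ∧ M.language O = L}

/-- The class `NP^O`. -/
def classNP (O : Set Word) : Set (Set Word) :=
  {L | ∃ (k n : ℕ) (M : Machine (Fin k) (Fin n)), M.PolyTime ∧ M.language O = L}

/-- The class `coNP^O`. -/
def classCoNP (O : Set Word) : Set (Set Word) :=
  {L | Lᶜ ∈ classNP O}

/-- The class `FP^O` of functions. -/
def classFP (O : Set Word) : Set (Word → Word) :=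
  {f | ∃ (k n : ℕ) (M : Machine (Fin k) (Fin n)),
    M.Deterministic ∧ M.PolyTime ∧ M.Computes O f}

/-- `f` is `P^O`-simulated by `g`. -/
def PSimulated (O : Set Word) (f g : Word → Word) : Prop :=
  ∃ π ∈ classFP O, ∃ p : Polynomial ℕ,
    ∀ x, (π x).length ≤ p.eval x.length ∧ g (π x) = f x

/-- `g` is a `P^O`-optimal proof system (for its range). -/
def POptimal (O : Set Word) (g : Word → Word) : Prop :=
  g ∈ classFP O ∧ ∀ f ∈ classFP O, Set.range f = Set.range g → PSimulated O f g

/-- The set `A` has a `P^O`-optimal proof system. -/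
def HasPOptimal (O : Set Word) (A : Set Word) : Prop :=
  ∃ g, POptimal O g ∧ Set.range g = A

/-- Polynomial-time many-one reducibility relative to `O`. -/
def ManyOneRed (O : Set Word) (A B : Set Word) : Prop :=
  ∃ r ∈ classFP O, ∀ x, x ∈ A ↔ r x ∈ B

/-- `A` is many-one complete for the class `C`, relative to `O`. -/
def ManyOneComplete (O : Set Word) (C : Set (Set Word)) (A : Set Word) : Prop :=
  A ∈ C ∧ ∀ B ∈ C, ManyOneRed O B A

/-- The conjecture `CON` relative to `O`: no many-one complete set of `coNP^O` has a `P^O`-optimal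
proof system. -/
def CON (O : Set Word) : Prop :=
  ¬ ∃ A, ManyOneComplete O (classCoNP O) A ∧ HasPOptimal O A

/-- The conjecture `SAT` relative to `O`: no many-one complete set of `NP^O` has a `P^O`-optimal
proof system. -/
def SAT (O : Set Word) : Prop :=
  ¬ ∃ A, ManyOneComplete O (classNP O) A ∧ HasPOptimal O A

end OracleTM

/-!
The oracle `O` is defined by recursion on the length of its words, and its words are of three
kinds (`Clause`), told apart by a number prefixed in unary (`tagged`).

* The words of the first kind form a generic set `G`. They make the set `guessSet 0 O = {x | ∃ z,
  |z| = |x| and O contains x ++ z}` of `NP^O` hard.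
* The words of the second kind record the outcome of the computation of a nondeterministic machine
  that follows a prescribed path. Hence `guessSet 1 O` is complete for `NP^O`
  (`manyOneComplete_guessSet`): a machine needs only guess a path and ask for its outcome, and a
  reduction needs only pad its input.
* The words of the third kind spell out, for every set `A` in `NP^O` or `coNP^O` with number `e`,
  the values of a proof system for `A`. A proof consists of an input `x` of some machine `i` and
  padding for its running time; its value is the output of the machine, provided that the machine
  is *sound*, that is, that all its outputs within the time allowed by the padding belong to `A`
  (`Sound`, `Proves`). Thus one proof system simulates all the others, the simulation being a mere
  padding (`IsOracle.pSimulated_readFn`). Soundness is decided in the definition of the oracle and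
  not by a computation. It is well-defined because the padding is longer than all the queries on
  which it depends. Proofs of a second kind, with exponential padding, ensure that the range of
  the proof system is all of `A`.

The machines needed are `guess`, which guesses a witness and submits it to the oracle, `reader`,
which reads its output from the oracle bit by bit, and `padder`, which pads polynomially. Their
running time has to be bounded for every oracle, so `reader` and `padder` carry their own clocks:
the former makes as many queries as its extended input is long, the latter counts with the
positions of its heads.

It remains to choose `G` such that `guessSet 0 O` is not in `P^O`. All the information that the
words of length at most `m` contain, apart from `G`, is of two sorts. The outcomes of computations
depend on few words of `G`, because a computation of `t` steps makes queries of total length at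
most `t`, and so a word `w` of the oracle depends on at most `|w|` words of `G`
(`IsOracle.exists_dependsOn`). The remaining information is the *advice*: which triples `(e, i,
k)` are sound. Soundness depends on very many words of `G`, but as time bounds enter through their
logarithm `k` only, and as `e` and `i` are required to be at most `k`, the words of length at most
`m` involve no more than `(log m + 1) ^ 3` bits of advice. So a polynomial-time machine, on inputs
of length `n`, can face fewer than `2 ^ n` different advices. In `exists_diagonal` each of them is
assigned an input of its own. With the advice fixed, the machine examines only polynomially many
words of `G`, so `G` can be changed on the words of length `2 n + 1` in such a way that the
machine, whatever the advice turns out to be, errs on the corresponding input. Meeting these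
requirements for all machines one after the other gives `G` (`exists_generic`).
-/

namespace OracleTM

/-! ### Computations of oracle machines -/

namespace Machine

variable {K Q : Type} {M : Machine K Q} {D D' : Set Word}

theorem Steps.exists_prefix {s t : ℕ} {a b : Cfg K Q} (h : M.Steps D t a b) (hs : s < t) :
    ∃ c c', M.Steps D s a c ∧ M.Step D c c' := by
  induction h with
  | zero => omega
  | @succ t a b c h₁ h₂ ih =>
    rcases Nat.lt_succ_iff_lt_or_eq.1 hs with h | rfl
    · exact ih h
    · exact ⟨b, c, h₁, h₂⟩

theorem halted_iff {c : Cfg K Q} :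
    M.Halted D c ↔ M.ask c.state = none ∧ M.trans c.state (fun i => (c.tape i).head) = ∅ := by
  unfold Halted Step
  rcases hq : M.ask c.state with _ | ⟨y, n⟩
  · simp only [true_and, Set.eq_empty_iff_forall_notMem]
    exact ⟨fun h a ha => h _ ⟨a, ha, rfl⟩, fun h c' ⟨a, ha, _⟩ => h a ha⟩
  · simp only [reduceCtorEq, false_and, iff_false, not_forall, not_not]
    by_cases h : c.query ∈ D
    · exact ⟨_, Or.inl ⟨h, rfl⟩⟩
    · exact ⟨_, Or.inr ⟨h, rfl⟩⟩

/-- Whether a configuration is halting does not depend on the oracle. -/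
theorem Halted.congr {c : Cfg K Q} (h : M.Halted D c) : M.Halted D' c :=
  halted_iff.2 (halted_iff.1 h)

theorem Deterministic.step_unique (hM : M.Deterministic) {c c₁ c₂ : Cfg K Q}
    (h₁ : M.Step D c c₁) (h₂ : M.Step D c c₂) : c₁ = c₂ := by
  unfold Step at h₁ h₂
  rcases hq : M.ask c.state with _ | ⟨y, n⟩
  · simp only [hq] at h₁ h₂
    obtain ⟨a, ha, rfl⟩ := h₁
    obtain ⟨b, hb, rfl⟩ := h₂
    rw [hM _ _ ha hb]
  · simp only [hq] at h₁ h₂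
    rcases h₁ with ⟨h, rfl⟩ | ⟨h, rfl⟩ <;> rcases h₂ with ⟨h', rfl⟩ | ⟨h', rfl⟩ <;> tauto

theorem Deterministic.steps_unique (hM : M.Deterministic) {t : ℕ} {c c₁ c₂ : Cfg K Q}
    (h₁ : M.Steps D t c c₁) (h₂ : M.Steps D t c c₂) : c₁ = c₂ := by
  induction h₁ generalizing c₂ with
  | zero => cases h₂; rfl
  | succ _ h ih =>
    cases h₂ with
    | succ h₂ h₂' =>
      obtain rfl := ih h₂
      exact hM.step_unique h h₂'

theorem Deterministic.le_of_halted (hM : M.Deterministic) {s t : ℕ} {c c₁ c₂ : Cfg K Q}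
    (h₁ : M.Steps D s c c₁) (h₂ : M.Steps D t c c₂) (h : M.Halted D c₂) : s ≤ t := by
  by_contra! hlt
  obtain ⟨c₃, c₄, h₃, h₄⟩ := h₁.exists_prefix hlt
  obtain rfl := hM.steps_unique h₂ h₃
  exact h _ h₄

theorem Deterministic.halted_unique (hM : M.Deterministic) {s t : ℕ} {c c₁ c₂ : Cfg K Q}
    (h₁ : M.Steps D s c c₁) (h₁' : M.Halted D c₁) (h₂ : M.Steps D t c c₂)
    (h₂' : M.Halted D c₂) : c₁ = c₂ := by
  obtain rfl := le_antisymm (hM.le_of_halted h₁ h₂ h₂') (hM.le_of_halted h₂ h₁ h₁')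
  exact hM.steps_unique h₁ h₂

theorem Step.query_length_le {c c' : Cfg K Q} (h : M.Step D c c') :
    c'.query.length ≤ c.query.length + 1 := by
  unfold Step at h
  rcases hq : M.ask c.state with _ | ⟨y, n⟩
  · simp only [hq] at h
    obtain ⟨a, -, rfl⟩ := h
    rcases ha : a.query <;> simp [Cfg.apply, ha]
  · simp only [hq] at h
    rcases h with ⟨h, rfl⟩ | ⟨h, rfl⟩ <;> simp

theorem Step.output_length_le {c c' : Cfg K Q} (h : M.Step D c c') :
    c'.output.length ≤ c.output.length + 1 := by
  unfold Step at h
  rcases hq : M.ask c.state with _ | ⟨y, n⟩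
  · simp only [hq] at h
    obtain ⟨a, -, rfl⟩ := h
    rcases ha : a.output <;> simp [Cfg.apply, ha]
  · simp only [hq] at h
    rcases h with ⟨h, rfl⟩ | ⟨h, rfl⟩ <;> simp

theorem Step.congr {c c' : Cfg K Q} (h : M.Step D c c') (hD : c.query ∈ D ↔ c.query ∈ D') :
    M.Step D' c c' := by
  unfold Step at h ⊢
  rcases hq : M.ask c.state with _ | ⟨y, n⟩
  · simpa only [hq] using h
  · simp only [hq] at h ⊢
    rwa [← hD]

theorem Steps.query_length_le {t : ℕ} {c c' : Cfg K Q} (h : M.Steps D t c c') :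
    c'.query.length ≤ c.query.length + t := by
  induction h with
  | zero => simp
  | succ _ h ih => have := h.query_length_le; omega

theorem Steps.output_length_le {t : ℕ} {c c' : Cfg K Q} (h : M.Steps D t c c') :
    c'.output.length ≤ c.output.length + t := by
  induction h with
  | zero => simp
  | succ _ h ih => have := h.output_length_le; omega

theorem Steps.congr {t : ℕ} {c c' : Cfg K Q} (h : M.Steps D t c c')
    (hD : ∀ w : Word, w.length ≤ c.query.length + t → (w ∈ D ↔ w ∈ D')) :
    M.Steps D' t c c' := by
  induction h with
  | zero => exact .zero _
  | @succ t a b c h₁ h₂ ih =>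
    refine .succ (ih fun w hw => hD w (by omega)) (h₂.congr (hD _ ?_))
    have := h₁.query_length_le
    omega

theorem mem_language_congr {p : Polynomial ℕ}
    (hp : ∀ (D : Set Word) (x : Word) (t : ℕ) (c : Cfg K Q),
      M.Steps D t (M.init x) c → t ≤ p.eval x.length) {x : Word}
    (hD : ∀ w : Word, w.length ≤ p.eval x.length → (w ∈ D ↔ w ∈ D')) :
    x ∈ M.language D ↔ x ∈ M.language D' := by
  have key : ∀ D D' : Set Word,
      (∀ w : Word, w.length ≤ p.eval x.length → (w ∈ D ↔ w ∈ D')) →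
      x ∈ M.language D → x ∈ M.language D' := by
    rintro D D' hD ⟨t, c, h, h', h''⟩
    have ht := hp D x t c h
    exact ⟨t, c, h.congr fun w hw => hD w (by simp [init] at hw; omega), h'.congr, h''⟩
  exact ⟨key _ _ hD, key _ _ fun w hw => (hD w hw).symm⟩

end Machine

/-! ### Renaming tapes and states -/

namespace Machine

variable {K Q K' Q' : Type}

/-- An instruction with its tapes and states renamed. -/
def _root_.OracleTM.Action.pull (eK : K ≃ K') (eQ : Q ≃ Q') (a : Action K' Q') : Action K Q where
  next := eQ.symm a.next
  write := a.write ∘ eK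
  move := a.move ∘ eK
  query := a.query
  output := a.output

/-- A configuration with its tapes and states renamed. -/
def _root_.OracleTM.Cfg.pull (eK : K ≃ K') (eQ : Q ≃ Q') (c : Cfg K' Q') : Cfg K Q where
  state := eQ.symm c.state
  tape := c.tape ∘ eK
  query := c.query
  output := c.output

theorem _root_.OracleTM.Cfg.pull_symm (eK : K ≃ K') (eQ : Q ≃ Q') (c : Cfg K Q) :
    (c.pull eK.symm eQ.symm).pull eK eQ = c := by
  simp [Cfg.pull, Function.comp_assoc]

theorem _root_.OracleTM.Cfg.pull_injective (eK : K ≃ K') (eQ : Q ≃ Q') :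
    Function.Injective (Cfg.pull eK eQ) := by
  intro c d h
  have := congrArg (Cfg.pull eK.symm eQ.symm) h
  cases c; cases d
  simpa [Cfg.pull, Function.comp_assoc] using this

/-- The machine with its tapes and states renamed. -/
def rename (M : Machine K Q) (eK : K ≃ K') (eQ : Q ≃ Q') : Machine K' Q' where
  start := eQ M.start
  accept := {q | eQ.symm q ∈ M.accept}
  inputTape := eK M.inputTape
  ask := fun q => (M.ask (eQ.symm q)).map (Prod.map eQ eQ)
  trans := fun q s => {a | a.pull eK eQ ∈ M.trans (eQ.symm q) (s ∘ eK)}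

variable (M : Machine K Q) (eK : K ≃ K') (eQ : Q ≃ Q') {D : Set Word}

theorem pull_apply (c : Cfg K' Q') (a : Action K' Q') :
    (c.apply a).pull eK eQ = (c.pull eK eQ).apply (a.pull eK eQ) := by
  simp only [Cfg.apply, Cfg.pull, Action.pull, Cfg.mk.injEq, true_and, and_true]
  funext i
  simp

theorem init_rename (x : Word) : ((M.rename eK eQ).init x).pull eK eQ = M.init x := by
  simp only [init, Cfg.pull, rename, Equiv.symm_apply_apply, Cfg.mk.injEq, true_and, and_true]
  funext i
  by_cases h : i = M.inputTape <;> simp [h]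

theorem step_rename (c c' : Cfg K' Q') :
    (M.rename eK eQ).Step D c c' ↔ M.Step D (c.pull eK eQ) (c'.pull eK eQ) := by
  unfold Step
  simp only [rename, Cfg.pull]
  rcases hq : M.ask (eQ.symm c.state) with _ | ⟨y, n⟩
  · simp only [Option.map_none]
    constructor
    · rintro ⟨a, ha, rfl⟩
      exact ⟨a.pull eK eQ, ha, pull_apply eK eQ c a⟩
    · rintro ⟨a, ha, h⟩
      have hp : (a.pull eK.symm eQ.symm).pull eK eQ = a := by
        simp [Action.pull, Function.comp_assoc]
      refine ⟨a.pull eK.symm eQ.symm, (congrArg (· ∈ _) hp).mpr ha, Cfg.pull_injective eK eQ ?_⟩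
      rw [pull_apply, hp]
      exact h
  · simp only [Option.map_some, Prod.map]
    refine or_congr (and_congr_right fun _ => ?_) (and_congr_right fun _ => ?_) <;>
    · rw [← (Cfg.pull_injective eK eQ).eq_iff]
      simp [Cfg.pull]

theorem steps_rename {t : ℕ} {c c' : Cfg K' Q'} :
    (M.rename eK eQ).Steps D t c c' ↔ M.Steps D t (c.pull eK eQ) (c'.pull eK eQ) := by
  constructor
  · intro h
    induction h with
    | zero => exact .zero _
    | succ _ h ih => exact ih.succ ((step_rename M eK eQ _ _).1 h)
  · generalize hd : c.pull eK eQ = d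
    generalize hd' : c'.pull eK eQ = d'
    intro h
    induction h generalizing c c' with
    | zero =>
      obtain rfl := Cfg.pull_injective eK eQ (hd.trans hd'.symm)
      exact .zero _
    | @succ t a b c₁ h₁ h ih =>
      refine .succ (ih hd (Cfg.pull_symm eK eQ b)) ((step_rename M eK eQ _ _).2 ?_)
      rwa [Cfg.pull_symm, hd']

theorem halted_rename {c : Cfg K' Q'} :
    (M.rename eK eQ).Halted D c ↔ M.Halted D (c.pull eK eQ) := by
  refine ⟨fun h c' hc => h (c'.pull eK.symm eQ.symm) ?_,
    fun h c' hc => h _ ((step_rename M eK eQ _ _).1 hc)⟩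
  rwa [step_rename, Cfg.pull_symm]

theorem exists_fin [Finite K] [Finite Q] (M : Machine K Q) :
    ∃ (k n : ℕ) (N : Machine (Fin k) (Fin n)), (M.Deterministic → N.Deterministic) ∧
      (M.PolyTime → N.PolyTime) ∧ (∀ D, N.language D = M.language D) ∧
      ∀ D f, M.Computes D f → N.Computes D f := by
  obtain ⟨k, ⟨eK⟩⟩ := Finite.exists_equiv_fin K
  obtain ⟨n, ⟨eQ⟩⟩ := Finite.exists_equiv_fin Q
  refine ⟨k, n, M.rename eK eQ, ?_, ?_, ?_, ?_⟩
  · intro h q s a ha b hb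
    have := h _ _ ha hb
    cases a; cases b
    simpa [Action.pull, eK.surjective.injective_comp_right.eq_iff] using this
  · rintro ⟨p, hp⟩
    refine ⟨p, fun D x t c h => hp D x t (c.pull eK eQ) ?_⟩
    rw [steps_rename, init_rename] at h
    exact h
  · intro D
    ext x
    constructor
    · rintro ⟨t, c, h, h', h''⟩
      rw [steps_rename, init_rename] at h
      exact ⟨t, _, h, (halted_rename M eK eQ).1 h', h''⟩
    · rintro ⟨t, c, h, h', h''⟩
      refine ⟨t, c.pull eK.symm eQ.symm, ?_, ?_, ?_⟩
      · rwa [steps_rename, init_rename, Cfg.pull_symm]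
      · rwa [halted_rename, Cfg.pull_symm]
      · simpa [rename, Cfg.pull] using h''
  · intro D f hf x
    obtain ⟨t, c, h, h', h''⟩ := hf x
    refine ⟨t, c.pull eK.symm eQ.symm, ?_, ?_, h''⟩
    · rwa [steps_rename, init_rename, Cfg.pull_symm]
    · rwa [halted_rename, Cfg.pull_symm]

end Machine

/-! ### Configurations with explicit head positions -/

/-- A configuration described by the contents of the cells of each tape, indexed by `ℤ`, together
with the position of each head. In contrast to `Cfg`, the tapes do not move under the heads. -/
structure ACfg (K Q : Type) where
  state : Q
  cell : K → ℤ → Option Bool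
  pos : K → ℤ
  query : Word
  output : Word

/-- The displacement of the head that a movement causes. -/
def shift : Option Turing.Dir → ℤ
  | none => 0
  | some .left => -1
  | some .right => 1

@[simp] theorem shift_none : shift none = 0 := rfl
@[simp] theorem shift_left : shift (some .left) = -1 := rfl
@[simp] theorem shift_right : shift (some .right) = 1 := rfl

/-- The result of executing an ordinary instruction. -/
def ACfg.apply {K Q : Type} (A : ACfg K Q) (a : Action K Q) : ACfg K Q where
  state := a.next
  cell := fun i => Function.update (A.cell i) (A.pos i) (a.write i)
  pos := fun i => A.pos i + shift (a.move i)
  query := A.query ++ a.query.toList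
  output := A.output ++ a.output.toList

/-- The configuration `c` is described by `A`. -/
structure Cfg.Rep {K Q : Type} (c : Cfg K Q) (A : ACfg K Q) : Prop where
  state : c.state = A.state
  tape : ∀ i z, (c.tape i).nth z = A.cell i (z + A.pos i)
  query : c.query = A.query
  output : c.output = A.output

/-- The contents of the cells of a tape that holds the word `x` from position `0` on. -/
def inputCells (x : Word) (z : ℤ) : Option Bool :=
  if z < 0 then none else x[z.toNat]?

theorem inputCells_natCast (x : Word) (i : ℕ) : inputCells x i = x[i]? := by
  simp [inputCells]

@[simp] theorem inputCells_neg_one (x : Word) : inputCells x (-1) = none := by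
  simp [inputCells]

namespace Machine

variable {K Q : Type} {M : Machine K Q} {D : Set Word}

/-- The relation corresponding to `Step` on configurations with explicit head positions. -/
def AStep (M : Machine K Q) (D : Set Word) (A A' : ACfg K Q) : Prop :=
  match M.ask A.state with
  | some (y, n) =>
      (A.query ∈ D ∧ A' = { A with state := y, query := [] }) ∨
      (A.query ∉ D ∧ A' = { A with state := n, query := [] })
  | none => ∃ a ∈ M.trans A.state (fun i => A.cell i (A.pos i)), A' = A.apply a

/-- The relation corresponding to `Steps` on configurations with explicit head positions. -/
inductive ASteps (M : Machine K Q) (D : Set Word) : ℕ → ACfg K Q → ACfg K Q → Prop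
  | zero (A : ACfg K Q) : ASteps M D 0 A A
  | succ {t : ℕ} {A B C : ACfg K Q} : ASteps M D t A B → M.AStep D B C → ASteps M D (t + 1) A C

/-- No instruction is available. -/
def AHalted (M : Machine K Q) (A : ACfg K Q) : Prop :=
  M.ask A.state = none ∧ M.trans A.state (fun i => A.cell i (A.pos i)) = ∅

open Classical in
/-- The start configuration on input `x`. -/
noncomputable def ainit (M : Machine K Q) (x : Word) : ACfg K Q where
  state := M.start
  cell := fun i => if i = M.inputTape then inputCells x else fun _ => none
  pos := fun _ => 0
  query := []
  output := []

theorem ASteps.trans {s t : ℕ} {A B C : ACfg K Q} (h₁ : M.ASteps D s A B)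
    (h₂ : M.ASteps D t B C) : M.ASteps D (s + t) A C := by
  induction h₂ with
  | zero => exact h₁
  | succ _ h ih => exact (ih h₁).succ h

theorem AStep.single {A B : ACfg K Q} (h : M.AStep D A B) : M.ASteps D 1 A B :=
  .succ (.zero A) h

theorem AStep.head {t : ℕ} {A B C : ACfg K Q} (h : M.AStep D A B) (h' : M.ASteps D t B C) :
    M.ASteps D (t + 1) A C :=
  (Nat.add_comm t 1) ▸ h.single.trans h'

theorem astep_of_action {A B : ACfg K Q} (a : Action K Q) (hq : M.ask A.state = none)
    (ha : a ∈ M.trans A.state (fun i => A.cell i (A.pos i))) (hB : A.apply a = B) :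
    M.AStep D A B := by
  unfold AStep
  rw [hq]
  exact ⟨a, ha, hB.symm⟩

theorem nth_mk₁ (x : Word) (z : ℤ) :
    (Turing.Tape.mk₁ (x.map some)).nth z = inputCells x z := by
  rcases z with n | n
  · have h := Turing.Tape.mk'_nth_nat (Turing.ListBlank.mk ([] : List (Option Bool)))
      (Turing.ListBlank.mk (x.map some)) n
    rw [Turing.ListBlank.nth_mk] at h
    rw [Int.ofNat_eq_natCast, inputCells_natCast]
    refine h.trans ?_
    rw [List.getI_eq_getElem?_getD, List.getElem?_map]
    cases x[n]? <;> rfl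
  · simp only [inputCells, Int.negSucc_lt_zero, if_true]
    change (Turing.ListBlank.mk ([] : List (Option Bool))).nth n = none
    rw [Turing.ListBlank.nth_mk]
    simp
    rfl

theorem nth_default (z : ℤ) : (default : Turing.Tape (Option Bool)).nth z = none := by
  exact (nth_mk₁ [] z).trans (by simp [inputCells])

theorem rep_init (M : Machine K Q) (x : Word) : (M.init x).Rep (M.ainit x) where
  state := rfl
  query := rfl
  output := rfl
  tape i z := by
    by_cases h : i = M.inputTape
    · simp [init, ainit, h, nth_mk₁]
    · simp [init, ainit, h, nth_default]

theorem _root_.OracleTM.Cfg.Rep.head {c : Cfg K Q} {A : ACfg K Q} (h : c.Rep A) :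
    (fun i => (c.tape i).head) = fun i => A.cell i (A.pos i) := by
  funext i
  have := h.tape i 0
  simpa using this

theorem _root_.OracleTM.Cfg.Rep.apply {c : Cfg K Q} {A : ACfg K Q} (h : c.Rep A)
    (a : Action K Q) : (c.apply a).Rep (A.apply a) where
  state := rfl
  query := by simp [Cfg.apply, ACfg.apply, h.query]
  output := by simp [Cfg.apply, ACfg.apply, h.output]
  tape i z := by
    have key : ∀ z, ((c.tape i).write (a.write i)).nth z =
        Function.update (A.cell i) (A.pos i) (a.write i) (z + A.pos i) := by
      intro z
      rw [Turing.Tape.write_nth, h.tape, Function.update_apply]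
      simp
    simp only [Cfg.apply, ACfg.apply]
    rcases a.move i with _ | _ | _
    · simpa using key z
    · rw [Turing.Tape.move_left_nth, key, shift_left]
      congr 1
      ring
    · rw [Turing.Tape.move_right_nth, key, shift_right]
      congr 1
      ring

theorem _root_.OracleTM.Cfg.Rep.step {c c' : Cfg K Q} {A : ACfg K Q} (h : c.Rep A)
    (hc : M.Step D c c') : ∃ A', M.AStep D A A' ∧ c'.Rep A' := by
  unfold Step at hc
  unfold AStep
  rw [h.state, h.head, h.query] at hc
  rcases hq : M.ask A.state with _ | ⟨y, n⟩
  · simp only [hq] at hc ⊢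
    obtain ⟨a, ha, rfl⟩ := hc
    exact ⟨_, ⟨a, ha, rfl⟩, h.apply a⟩
  · simp only [hq] at hc ⊢
    rcases hc with ⟨hc, rfl⟩ | ⟨hc, rfl⟩
    · exact ⟨_, Or.inl ⟨hc, rfl⟩, rfl, h.tape, rfl, h.output⟩
    · exact ⟨_, Or.inr ⟨hc, rfl⟩, rfl, h.tape, rfl, h.output⟩

theorem _root_.OracleTM.Cfg.Rep.astep {c : Cfg K Q} {A A' : ACfg K Q} (h : c.Rep A)
    (hA : M.AStep D A A') : ∃ c', M.Step D c c' ∧ c'.Rep A' := by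
  unfold Step
  unfold AStep at hA
  rw [h.state, h.head, h.query]
  rcases hq : M.ask A.state with _ | ⟨y, n⟩
  · simp only [hq] at hA ⊢
    obtain ⟨a, ha, rfl⟩ := hA
    exact ⟨_, ⟨a, ha, rfl⟩, h.apply a⟩
  · simp only [hq] at hA ⊢
    rcases hA with ⟨hA, rfl⟩ | ⟨hA, rfl⟩
    · exact ⟨_, Or.inl ⟨hA, rfl⟩, rfl, h.tape, rfl, h.output⟩
    · exact ⟨_, Or.inr ⟨hA, rfl⟩, rfl, h.tape, rfl, h.output⟩

theorem _root_.OracleTM.Cfg.Rep.steps {t : ℕ} {c c' : Cfg K Q} {A : ACfg K Q} (h : c.Rep A)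
    (hc : M.Steps D t c c') : ∃ A', M.ASteps D t A A' ∧ c'.Rep A' := by
  induction hc with
  | zero => exact ⟨A, .zero A, h⟩
  | succ _ hc ih =>
    obtain ⟨B, hB, h'⟩ := ih h
    obtain ⟨C, hC, h''⟩ := h'.step hc
    exact ⟨C, hB.succ hC, h''⟩

theorem _root_.OracleTM.Cfg.Rep.asteps {t : ℕ} {c : Cfg K Q} {A A' : ACfg K Q} (h : c.Rep A)
    (hA : M.ASteps D t A A') : ∃ c', M.Steps D t c c' ∧ c'.Rep A' := by
  induction hA with
  | zero => exact ⟨c, .zero c, h⟩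
  | succ _ hA ih =>
    obtain ⟨b, hb, h'⟩ := ih h
    obtain ⟨d, hd, h''⟩ := h'.astep hA
    exact ⟨d, hb.succ hd, h''⟩

theorem _root_.OracleTM.Cfg.Rep.halted {c : Cfg K Q} {A : ACfg K Q} (h : c.Rep A) :
    M.Halted D c ↔ M.AHalted A := by
  rw [halted_iff, AHalted, h.state, h.head]

theorem mem_language_iff {x : Word} : x ∈ M.language D ↔
    ∃ t A, M.ASteps D t (M.ainit x) A ∧ M.AHalted A ∧ A.state ∈ M.accept := by
  constructor
  · rintro ⟨t, c, h, h', h''⟩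
    obtain ⟨A, hA, hc⟩ := (M.rep_init x).steps h
    exact ⟨t, A, hA, hc.halted.1 h', hc.state ▸ h''⟩
  · rintro ⟨t, A, h, h', h''⟩
    obtain ⟨c, hA, hc⟩ := (M.rep_init x).asteps h
    exact ⟨t, c, hA, hc.halted.2 h', hc.state.symm ▸ h''⟩

theorem polyTime_of_asteps (p : Polynomial ℕ)
    (h : ∀ (D : Set Word) x t A, M.ASteps D t (M.ainit x) A → t ≤ p.eval x.length) :
    M.PolyTime := by
  refine ⟨p, fun D x t c hc => ?_⟩
  obtain ⟨A, hA, -⟩ := (M.rep_init x).steps hc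
  exact h D x t A hA

/-- A deterministic machine over finite types of tapes and states that halts, with every oracle,
within a polynomial time bound computes a function in `FP^O`. -/
theorem mem_classFP [Finite K] [Finite Q] (hM : M.Deterministic) (p : Polynomial ℕ)
    (f : Set Word → Word → Word)
    (h : ∀ (D : Set Word) x, ∃ t A, t ≤ p.eval x.length ∧ M.ASteps D t (M.ainit x) A ∧
      M.AHalted A ∧ A.output = f D x) (O : Set Word) : f O ∈ classFP O := by
  obtain ⟨k, n, N, hdet, hpoly, -, hcomp⟩ := exists_fin M
  refine ⟨k, n, N, hdet hM, hpoly ⟨p, fun D x t c hc => ?_⟩, hcomp O _ fun x => ?_⟩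
  · obtain ⟨s, A, hs, hA, hA', -⟩ := h D x
    obtain ⟨d, hd, hd'⟩ := (M.rep_init x).asteps hA
    exact (hM.le_of_halted hc hd (hd'.halted.2 hA')).trans hs
  · obtain ⟨s, A, hs, hA, hA', hout⟩ := h O x
    obtain ⟨d, hd, hd'⟩ := (M.rep_init x).asteps hA
    exact ⟨s, d, hd, hd'.halted.2 hA', hd'.output.trans hout⟩

end Machine

/-! ### A nondeterministic machine that guesses a witness -/

/-- The word `body` with the number `e` prefixed in unary. -/
def tagged (e : ℕ) (body : Word) : Word := List.replicate e true ++ false :: body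

@[simp] theorem length_tagged (e : ℕ) (b : Word) : (tagged e b).length = e + 1 + b.length := by
  simp [tagged]; omega

theorem tagged_inj {e e' : ℕ} {b b' : Word} : tagged e b = tagged e' b' ↔ e = e' ∧ b = b' := by
  refine ⟨fun h => ?_, fun ⟨h, h'⟩ => h ▸ h' ▸ rfl⟩
  induction e generalizing e' with
  | zero =>
    cases e' with
    | zero => simpa [tagged] using h
    | succ e' => simp [tagged, List.replicate_succ] at h
  | succ e ih =>
    cases e' with
    | zero => simp [tagged, List.replicate_succ] at h
    | succ e' =>
      simp only [tagged, List.replicate_succ, List.cons_append, List.cons.injEq, true_and] at h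
      exact (ih h).imp (congrArg _) id

/-- The states of the machine `guess e`. -/
inductive GuessState (e : ℕ)
  | tag (l : Fin (e + 1))
  | scan
  | back
  | ask
  | yes
  | no

instance (e : ℕ) : Finite (GuessState e) :=
  Finite.of_injective
    (fun q : GuessState e => match q with
      | .tag l => (Sum.inl l : Fin (e + 1) ⊕ Fin 5)
      | .scan => .inr 0
      | .back => .inr 1
      | .ask => .inr 2
      | .yes => .inr 3
      | .no => .inr 4)
    (by intro a b h; cases a <;> cases b <;> simp_all)

/-- The machine that on input `u` writes `tagged e (u ++ z)` on its query tape, where `z` is a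
guessed word of the length of `u`, submits it to the oracle and accepts if the answer is yes. The
word `z` is guessed while the head returns from the end of the input. -/
def guess (e : ℕ) : Machine Unit (GuessState e) where
  start := .tag (Fin.last e)
  accept := {.yes}
  inputTape := ()
  ask
    | .ask => some (.yes, .no)
    | _ => none
  trans q s :=
    match q with
    | .tag ⟨l + 1, h⟩ => {⟨.tag ⟨l, by omega⟩, s, fun _ => none, some true, none⟩}
    | .tag ⟨0, _⟩ => {⟨.scan, s, fun _ => none, some false, none⟩}
    | .scan =>
      match s () with
      | some b => {⟨.scan, s, fun _ => some .right, some b, none⟩}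
      | none => {⟨.back, s, fun _ => some .left, none, none⟩}
    | .back =>
      match s () with
      | some _ => Set.range fun b => ⟨.back, s, fun _ => some .left, some b, none⟩
      | none => {⟨.ask, s, fun _ => none, none, none⟩}
    | _ => ∅

namespace guess

/-- The configurations of `guess e` on input `x`. -/
def conf (e : ℕ) (x : Word) (q : GuessState e) (p : ℤ) (w : Word) : ACfg Unit (GuessState e) :=
  ⟨q, fun _ => inputCells x, fun _ => p, w, []⟩

/-- The reachable configurations of `guess e` on input `x`, with bounds on the remaining time. -/
inductive Reach (e : ℕ) (x : Word) (D : Set Word) : ℕ → ACfg Unit (GuessState e) → Prop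
  | tag (l : ℕ) (h : l < e + 1) : Reach e x D (l + 2 * x.length + 5)
      (conf e x (.tag ⟨l, h⟩) 0 (List.replicate (e - l) true))
  | scan (i : ℕ) (h : i ≤ x.length) : Reach e x D (2 * x.length - i + 4)
      (conf e x .scan i (tagged e (x.take i)))
  | back (i : ℕ) (z : Word) (h : z.length + i = x.length) : Reach e x D (i + 3)
      (conf e x .back (i - 1) (tagged e (x ++ z)))
  | ask (z : Word) (h : z.length = x.length) : Reach e x D 1
      (conf e x .ask (-1) (tagged e (x ++ z)))
  | yes (z : Word) (h : z.length = x.length) (hD : tagged e (x ++ z) ∈ D) : Reach e x D 0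
      (conf e x .yes (-1) [])
  | no : Reach e x D 0 (conf e x .no (-1) [])

variable {e : ℕ} {x : Word} {D : Set Word}

theorem ainit_eq : (guess e).ainit x = conf e x (.tag (Fin.last e)) 0 [] := by
  simp [Machine.ainit, conf, guess]

theorem apply_conf (q q' : GuessState e) (p : ℤ) (w : Word) (d : Option Turing.Dir)
    (b : Option Bool) {v : Option Bool} (hv : v = inputCells x p) :
    (conf e x q p w).apply ⟨q', fun _ => v, fun _ => d, b, none⟩ =
      conf e x q' (p + shift d) (w ++ b.toList) := by
  simp [ACfg.apply, conf, hv]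

theorem step_tag_succ (l : ℕ) (h : l + 1 < e + 1) (w : Word) (B) :
    (guess e).AStep D (conf e x (.tag ⟨l + 1, h⟩) 0 w) B ↔
      B = conf e x (.tag ⟨l, by omega⟩) 0 (w ++ [true]) := by
  simp only [Machine.AStep, guess, conf, Set.mem_singleton_iff, exists_eq_left]
  exact Iff.of_eq (congrArg (B = ·) (apply_conf _ _ _ _ _ _ rfl))

theorem step_tag_zero (h : 0 < e + 1) (w : Word) (B) :
    (guess e).AStep D (conf e x (.tag ⟨0, h⟩) 0 w) B ↔
      B = conf e x .scan 0 (w ++ [false]) := by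
  simp only [Machine.AStep, guess, conf, Set.mem_singleton_iff, exists_eq_left]
  exact Iff.of_eq (congrArg (B = ·) (apply_conf _ _ _ _ _ _ rfl))

theorem step_scan_lt (i : ℕ) (h : i < x.length) (w : Word) (B) :
    (guess e).AStep D (conf e x .scan i w) B ↔
      B = conf e x .scan (i + 1 : ℕ) (w ++ [x[i]]) := by
  simp only [Machine.AStep, guess, conf, inputCells_natCast, List.getElem?_eq_getElem h,
    Set.mem_singleton_iff, exists_eq_left]
  have hv : some x[i] = inputCells x i := by
    rw [inputCells_natCast, List.getElem?_eq_getElem h]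
  exact Iff.of_eq (congrArg (B = ·) (apply_conf _ _ _ _ _ _ hv))

theorem step_scan_end (w : Word) (B) :
    (guess e).AStep D (conf e x .scan x.length w) B ↔
      B = conf e x .back (x.length - 1) w := by
  simp only [Machine.AStep, guess, conf, inputCells_natCast, List.getElem?_length,
    Set.mem_singleton_iff, exists_eq_left]
  have hv : none = inputCells x x.length := by
    rw [inputCells_natCast, List.getElem?_length]
  refine Iff.of_eq (congrArg (B = ·) ((apply_conf _ _ _ _ _ _ hv).trans ?_))
  simp [conf, sub_eq_add_neg]

theorem step_back_succ (i : ℕ) (h : i < x.length) (w : Word) (B) :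
    (guess e).AStep D (conf e x .back ((i + 1 : ℕ) - 1) w) B ↔
      ∃ b, B = conf e x .back (i - 1) (w ++ [b]) := by
  simp only [Nat.cast_add, Nat.cast_one, add_sub_cancel_right]
  simp only [Machine.AStep, guess, conf, inputCells_natCast, List.getElem?_eq_getElem h,
    Set.mem_range, exists_exists_eq_and]
  have hv : some x[i] = inputCells x i := by
    rw [inputCells_natCast, List.getElem?_eq_getElem h]
  refine exists_congr fun b =>
    Iff.of_eq (congrArg (B = ·) ((apply_conf _ _ _ _ _ _ hv).trans ?_))
  simp [conf, sub_eq_add_neg]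

theorem step_back_zero (w : Word) (B) :
    (guess e).AStep D (conf e x .back (-1) w) B ↔ B = conf e x .ask (-1) w := by
  simp only [Machine.AStep, guess, conf, inputCells_neg_one, Set.mem_singleton_iff,
    exists_eq_left]
  refine Iff.of_eq (congrArg (B = ·)
    ((apply_conf _ _ _ _ _ _ (inputCells_neg_one x).symm).trans ?_))
  simp [conf]

theorem step_ask (w : Word) (B) :
    (guess e).AStep D (conf e x .ask (-1) w) B ↔
      (w ∈ D ∧ B = conf e x .yes (-1) []) ∨ (w ∉ D ∧ B = conf e x .no (-1) []) := by
  rfl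

theorem Reach.step {s : ℕ} {A B} (h : Reach e x D s A) (hB : (guess e).AStep D A B) :
    ∃ s' < s, Reach e x D s' B := by
  cases h with
  | tag l h =>
    cases l with
    | zero =>
      rw [step_tag_zero] at hB
      subst hB
      refine ⟨_, ?_, .scan 0 (Nat.zero_le _)⟩
      omega
    | succ l =>
      rw [step_tag_succ] at hB
      subst hB
      refine ⟨l + 2 * x.length + 5, by omega, ?_⟩
      rw [← List.replicate_succ', show e - (l + 1) + 1 = e - l by omega]
      exact .tag l (by omega)
  | scan i h =>
    rcases h.lt_or_eq with h | rfl
    · rw [step_scan_lt i h] at hB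
      subst hB
      refine ⟨2 * x.length - (i + 1) + 4, by omega, ?_⟩
      have : tagged e (x.take i) ++ [x[i]] = tagged e (x.take (i + 1)) := by
        rw [List.take_succ_eq_append_getElem h]
        simp [tagged]
      rw [this]
      exact .scan (i + 1) h
    · rw [step_scan_end] at hB
      subst hB
      refine ⟨x.length + 3, by omega, ?_⟩
      have := Reach.back (e := e) (x := x) (D := D) x.length [] (by simp)
      simpa using this
  | back i z h =>
    cases i with
    | zero =>
      rw [Nat.cast_zero, zero_sub, step_back_zero] at hB
      subst hB
      exact ⟨1, by omega, .ask z (by simpa using h)⟩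
    | succ i =>
      rw [step_back_succ i (by omega)] at hB
      obtain ⟨b, rfl⟩ := hB
      refine ⟨i + 3, by omega, ?_⟩
      have : tagged e (x ++ z) ++ [b] = tagged e (x ++ (z ++ [b])) := by simp [tagged]
      rw [this]
      exact .back i _ (by simp; omega)
  | ask z h =>
    rw [step_ask] at hB
    rcases hB with ⟨hB, rfl⟩ | ⟨hB, rfl⟩
    · exact ⟨0, by omega, .yes z h hB⟩
    · exact ⟨0, by omega, .no⟩
  | yes z h hD =>
    obtain ⟨a, ha, -⟩ := hB
    exact ha.elim
  | no =>
    obtain ⟨a, ha, -⟩ := hB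
    exact ha.elim

theorem reach_of_asteps {t : ℕ} {A} (h : (guess e).ASteps D t ((guess e).ainit x) A) :
    ∃ s, s + t ≤ e + 2 * x.length + 5 ∧ Reach e x D s A := by
  generalize hA : (guess e).ainit x = A₀ at h
  induction h with
  | zero =>
    subst hA
    refine ⟨_, le_rfl, ?_⟩
    rw [ainit_eq]
    have := Reach.tag (x := x) (D := D) e (Nat.lt_succ_self e)
    rwa [Nat.sub_self] at this
  | succ _ h ih =>
    obtain ⟨s, hs, hr⟩ := ih hA
    obtain ⟨s', hs', hr'⟩ := hr.step h
    exact ⟨s', by omega, hr'⟩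

theorem polyTime (e : ℕ) : (guess e).PolyTime := by
  refine Machine.polyTime_of_asteps (2 * .X + .C (e + 5)) fun D x t A h => ?_
  obtain ⟨s, hs, -⟩ := reach_of_asteps h
  simp
  omega

theorem asteps_tag (l : ℕ) (h : l < e + 1) : ∃ t, (guess e).ASteps D t
    (conf e x (.tag ⟨l, h⟩) 0 (List.replicate (e - l) true)) (conf e x .scan 0 (tagged e [])) := by
  induction l with
  | zero => exact ⟨1, ((step_tag_zero h _ _).2 rfl).single⟩
  | succ l ih =>
    obtain ⟨t, ht⟩ := ih (by omega)
    refine ⟨t + 1, ((step_tag_succ l h _ _).2 ?_).head ht⟩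
    rw [← List.replicate_succ', show e - (l + 1) + 1 = e - l by omega]

theorem asteps_scan (i : ℕ) (h : i ≤ x.length) : ∃ t, (guess e).ASteps D t
    (conf e x .scan 0 (tagged e [])) (conf e x .scan i (tagged e (x.take i))) := by
  induction i with
  | zero => exact ⟨0, by simpa using .zero _⟩
  | succ i ih =>
    obtain ⟨t, ht⟩ := ih (by omega)
    refine ⟨t + 1, ht.succ ((step_scan_lt i h _ _).2 ?_)⟩
    rw [List.take_succ_eq_append_getElem (show i < x.length by omega)]
    simp [tagged]

theorem asteps_back (z : Word) (w : Word) (h : z.length ≤ x.length) : ∃ t, (guess e).ASteps D t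
    (conf e x .back (z.length - 1) w) (conf e x .back (-1) (w ++ z)) := by
  induction z generalizing w with
  | nil => exact ⟨0, by simpa using .zero _⟩
  | cons b z ih =>
    simp only [List.length_cons] at h
    obtain ⟨t, ht⟩ := ih (w ++ [b]) (by omega)
    refine ⟨t + 1, Machine.AStep.head ((step_back_succ z.length h w _).2 ⟨b, rfl⟩) ?_⟩
    simpa using ht

theorem mem_language {e : ℕ} {D : Set Word} {x : Word} :
    x ∈ (guess e).language D ↔ ∃ z : Word, z.length = x.length ∧ tagged e (x ++ z) ∈ D := by
  rw [Machine.mem_language_iff]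
  constructor
  · rintro ⟨t, A, h, -, h'⟩
    obtain ⟨s, -, hr⟩ := reach_of_asteps h
    cases hr with
    | yes z hz hD => exact ⟨z, hz, hD⟩
    | _ => simp [conf, guess] at h'
  · rintro ⟨z, hz, hD⟩
    obtain ⟨t₁, h₁⟩ := asteps_tag (x := x) (D := D) e (Nat.lt_succ_self e)
    obtain ⟨t₂, h₂⟩ := asteps_scan (e := e) (x := x) (D := D) x.length le_rfl
    obtain ⟨t₃, h₃⟩ := asteps_back (e := e) (x := x) (D := D) z (tagged e x) hz.le
    rw [List.take_length] at h₂
    rw [Nat.sub_self, List.replicate_zero] at h₁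
    have h₂₃ := h₂.succ ((step_scan_end _ _).2 rfl)
    rw [hz] at h₃
    have h₄ := ((h₁.trans h₂₃).trans h₃).succ ((step_back_zero _ _).2 rfl)
    have h₅ := h₄.succ ((step_ask _ _).2 (Or.inl ⟨by simpa [tagged] using hD, rfl⟩))
    exact ⟨_, _, ainit_eq ▸ h₅, ⟨rfl, rfl⟩, Set.mem_singleton _⟩

end guess

/-- The set of all words with a witness of the same length that the oracle confirms under the
tag `e`. -/
def guessSet (e : ℕ) (O : Set Word) : Set Word :=
  {x | ∃ z : Word, z.length = x.length ∧ tagged e (x ++ z) ∈ O}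

theorem guessSet_mem_classNP (e : ℕ) (O : Set Word) : guessSet e O ∈ classNP O := by
  obtain ⟨k, n, N, -, hpoly, hlang, -⟩ := (guess e).exists_fin
  exact ⟨k, n, N, hpoly (guess.polyTime e), by
    rw [hlang]; ext x; exact guess.mem_language⟩

/-! ### A machine that reads its output from the oracle -/

/-- The word `u` with each letter followed by a marker bit; the first `j` markers are set. -/
def marked : Word → ℕ → Word
  | [], _ => []
  | b :: u, 0 => b :: false :: marked u 0
  | b :: u, j + 1 => b :: true :: marked u j

theorem marked_concat (u : Word) (b : Bool) (j : ℕ) :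
    marked (u ++ [b]) j = marked u j ++ [b, decide (u.length < j)] := by
  induction u generalizing j with
  | nil => cases j <;> simp [marked]
  | cons a u ih => cases j <;> simp [marked, ih]

@[simp] theorem length_marked (u : Word) (j : ℕ) : (marked u j).length = 2 * u.length := by
  induction u generalizing j with
  | nil => simp [marked]
  | cons a u ih => cases j <;> simp [marked, ih] <;> omega

theorem marked_inj {u u' : Word} {j j' : ℕ} (hj : j ≤ u.length) (hj' : j' ≤ u'.length) :
    marked u j = marked u' j' ↔ u = u' ∧ j = j' := by
  refine ⟨fun h => ?_, fun ⟨h, h'⟩ => h ▸ h' ▸ rfl⟩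
  induction u generalizing u' j j' with
  | nil =>
    have hl := congrArg List.length h
    simp only [length_marked, List.length_nil] at hl hj
    have : u' = [] := List.length_eq_zero_iff.1 (by omega)
    subst this
    exact ⟨rfl, by simp at hj'; omega⟩
  | cons a u ih =>
    cases u' with
    | nil => cases j <;> simp [marked] at h
    | cons a' u' =>
      simp only [List.length_cons] at hj hj'
      cases j <;> cases j' <;> simp only [marked, List.cons.injEq] at h
      · simpa [h.1] using ih (Nat.zero_le _) (Nat.zero_le _) h.2.2
      · simp at h
      · simp at h
      · simpa [h.1] using ih (by omega) (by omega) h.2.2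

/-- The states of the machine `reader e c`. -/
inductive ReadState (e c : ℕ)
  | find
  | extend (l : Fin (c + 1))
  | tag (par : Bool) (l : Fin (e + 1))
  | letter (par flag : Bool)
  | marker (par flag : Bool)
  | ask (par : Bool)
  | answer (par ans : Bool)
  | back (par : Bool)

instance (e c : ℕ) : Finite (ReadState e c) :=
  Finite.of_injective
    (fun q : ReadState e c => match q with
      | .find => ((Sum.inr (.inr 0) : Fin (e + 1) ⊕ (Fin (c + 1) ⊕ Fin 6)), false, false)
      | .extend l => (.inr (.inl l), false, false)
      | .tag par l => (.inl l, par, false)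
      | .letter par flag => (.inr (.inr 1), par, flag)
      | .marker par flag => (.inr (.inr 2), par, flag)
      | .ask par => (.inr (.inr 3), par, false)
      | .answer par ans => (.inr (.inr 4), par, ans)
      | .back par => (.inr (.inr 5), par, false))
    (by intro a b h; cases a <;> cases b <;> simp_all)

/-- The machine that on input `v` extends `v` to the word `u` by `c` letters `1`, submits the words
`tagged e (marked u j)` for `j < u.length` one after the other to the oracle and, whenever the
answer is yes, outputs the parity of `j`. The tape `false` is the input tape, the tape `true` holds
`j` in unary. In each round, the first unmarked cell of the latter gets marked, which sets the
component `flag` of the state; the machine halts when there is no such cell within the length of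
`u`. The extension makes sure that even for short inputs there are enough rounds to output a given
word. -/
def reader (e c : ℕ) : Machine Bool (ReadState e c) where
  start := .find
  accept := ∅
  inputTape := false
  ask
    | .ask par => some (.answer par true, .answer par false)
    | _ => none
  trans q s :=
    match q with
    | .find =>
      match s false with
      | some _ => {⟨.find, s, fun _ => some .right, none, none⟩}
      | none => {⟨.extend (Fin.last c), s, fun _ => none, none, none⟩}
    | .extend ⟨l + 1, h⟩ => {⟨.extend ⟨l, by omega⟩, fun i => if i then s true else some true,
        fun _ => some .right, none, none⟩}
    | .extend ⟨0, _⟩ => {⟨.back true, s, fun _ => some .left, none, none⟩}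
    | .tag par ⟨l + 1, h⟩ => {⟨.tag par ⟨l, by omega⟩, s, fun _ => none, some true, none⟩}
    | .tag par ⟨0, _⟩ => {⟨.letter par false, s, fun _ => none, some false, none⟩}
    | .letter par flag =>
      match s false, flag with
      | some b, flag => {⟨.marker par flag, s, fun _ => none, some b, none⟩}
      | none, true => {⟨.ask par, s, fun _ => none, none, none⟩}
      | none, false => ∅
    | .marker par flag =>
      match s true with
      | some _ => {⟨.letter par flag, s, fun _ => some .right, some true, none⟩}
      | none => {⟨.letter par true, fun i => if i ∧ !flag then some true else s i,
          fun _ => some .right, some false, none⟩}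
    | .ask _ => ∅
    | .answer par ans =>
      {⟨.back par, s, fun _ => some .left, none, if ans then some par else none⟩}
    | .back par =>
      match s false with
      | some _ => {⟨.back par, s, fun _ => some .left, none, none⟩}
      | none => {⟨.tag (!par) (Fin.last e), s, fun _ => some .right, none, none⟩}

/-- The contents of a tape on which the cells `0, …, j - 1` are marked. -/
def markCells (j : ℕ) (z : ℤ) : Option Bool := if 0 ≤ z ∧ z < j then some true else none

theorem markCells_lt {i j : ℕ} (h : i < j) : markCells j i = some true := by
  simp [markCells, h]

theorem markCells_ge {i j : ℕ} (h : j ≤ i) : markCells j i = none := by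
  simp [markCells, h]

theorem update_markCells (j : ℕ) :
    Function.update (markCells j) j (some true) = markCells (j + 1) := by
  funext z
  simp only [Function.update_apply, markCells, Nat.cast_add, Nat.cast_one]
  split_ifs <;> first | rfl | omega

open Classical in
/-- The word that the oracle `D` holds for the word `u` under the tag `e`. -/
noncomputable def readOut (e : ℕ) (D : Set Word) (u : Word) : Word :=
  (List.range u.length).flatMap fun j => if tagged e (marked u j) ∈ D then [j.bodd] else []

namespace reader

variable {e c : ℕ} {u : Word} {D : Set Word}

theorem deterministic (e c : ℕ) : (reader e c).Deterministic := by
  intro q s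
  unfold reader
  dsimp only
  split <;> (try split) <;>
    first | exact Set.subsingleton_singleton | exact Set.subsingleton_empty

/-- The configurations of `reader e c` on input `u`. -/
def conf (u : Word) (q : ReadState e c) (m : ℤ → Option Bool) (p : ℤ) (w o : Word) :
    ACfg Bool (ReadState e c) :=
  ⟨q, fun i => if i then m else inputCells u, fun _ => p, w, o⟩

theorem ainit_eq : (reader e c).ainit u =
    conf u .find (markCells 0) 0 [] [] := by
  simp only [Machine.ainit, conf, reader, ACfg.mk.injEq, true_and, and_true]
  funext i z
  cases i
  · simp
  · simp [markCells]

theorem apply_conf (q q' : ReadState e c) (m : ℤ → Option Bool) (p : ℤ) (w o : Word)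
    (d : Option Turing.Dir) (b b' : Option Bool) {s : Bool → Option Bool}
    (hs : s = fun i => (if i then m else inputCells u) p) :
    (conf u q m p w o).apply ⟨q', s, fun _ => d, b, b'⟩ =
      conf u q' m (p + shift d) (w ++ b.toList) (o ++ b'.toList) := by
  subst hs
  simp [ACfg.apply, conf]

theorem step_tag_succ (par : Bool) (l : ℕ) (h : l + 1 < e + 1) (m : ℤ → Option Bool)
    (w o : Word) : (reader e c).AStep D (conf u (.tag par ⟨l + 1, h⟩) m 0 w o)
      (conf u (.tag par ⟨l, by omega⟩) m 0 (w ++ [true]) o) :=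
  Machine.astep_of_action _ rfl rfl
    ((apply_conf _ _ _ _ _ _ none _ none rfl).trans (by simp))

theorem step_tag_zero (par : Bool) (h : 0 < e + 1) (m : ℤ → Option Bool)
    (w o : Word) : (reader e c).AStep D (conf u (.tag par ⟨0, h⟩) m 0 w o)
      (conf u (.letter par false) m 0 (w ++ [false]) o) :=
  Machine.astep_of_action _ rfl rfl
    ((apply_conf _ _ _ _ _ _ none _ none rfl).trans (by simp))

theorem asteps_tag (par : Bool) (l : ℕ) (h : l < e + 1) (m : ℤ → Option Bool) (o : Word) :
    (reader e c).ASteps D (l + 1) (conf u (.tag par ⟨l, h⟩) m 0 (List.replicate (e - l) true) o)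
      (conf u (.letter par false) m 0 (tagged e []) o) := by
  induction l with
  | zero => exact (step_tag_zero par h m _ o).single
  | succ l ih =>
    refine (step_tag_succ par l h m _ o).head ?_
    rw [← List.replicate_succ', show e - (l + 1) + 1 = e - l by omega]
    exact ih (by omega)

theorem step_letter (par flag : Bool) (m : ℤ → Option Bool) (i : ℕ) (h : i < u.length)
    (w o : Word) : (reader e c).AStep D (conf u (.letter par flag) m i w o)
      (conf u (.marker par flag) m i (w ++ [u[i]]) o) := by
  have hv : inputCells u i = some u[i] := by
    rw [inputCells_natCast, List.getElem?_eq_getElem h]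
  refine Machine.astep_of_action _ rfl ?_
    ((apply_conf _ (.marker par flag) _ _ _ _ none (some u[i]) none rfl).trans (by simp))
  simp [reader, conf, hv]

theorem step_marker_some (par flag : Bool) (j i : ℕ) (h : i < j) (w o : Word) :
    (reader e c).AStep D (conf u (.marker par flag) (markCells j) i w o)
      (conf u (.letter par flag) (markCells j) (i + 1 : ℕ) (w ++ [true]) o) := by
  refine Machine.astep_of_action _ rfl ?_
    ((apply_conf _ (.letter par flag) _ _ _ _ (some .right) (some true) none rfl).trans (by simp))
  simp [reader, conf, markCells_lt h]

theorem step_marker_none (par : Bool) (j i : ℕ) (h : j ≤ i) (w o : Word) :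
    (reader e c).AStep D (conf u (.marker par true) (markCells j) i w o)
      (conf u (.letter par true) (markCells j) (i + 1 : ℕ) (w ++ [false]) o) := by
  refine Machine.astep_of_action _ rfl ?_
    ((apply_conf _ (.letter par true) _ _ _ _ (some .right) (some false) none rfl).trans (by simp))
  simp [reader, conf, markCells_ge h]

theorem step_marker_new (par : Bool) (j : ℕ) (w o : Word) :
    (reader e c).AStep D (conf u (.marker par false) (markCells j) j w o)
      (conf u (.letter par true) (markCells (j + 1)) (j + 1 : ℕ) (w ++ [false]) o) := by
  refine Machine.astep_of_action ⟨.letter par true,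
    fun i => if i then some true else inputCells u j, fun _ => some .right, some false, none⟩
    rfl ?_ ?_
  · simp only [reader, conf, markCells_ge le_rfl, if_true, Set.mem_singleton_iff, Action.mk.injEq,
      true_and, and_true]
    funext i
    cases i <;> simp
  · simp only [ACfg.apply, conf, ACfg.mk.injEq, true_and, Option.toList_none, List.append_nil,
      and_true]
    refine ⟨?_, by simp⟩
    funext i
    cases i <;> simp [update_markCells]

/-- The configuration in round `j` after the first `i` cells have been scanned. -/
theorem asteps_scan (par : Bool) (j i : ℕ) (hi : i ≤ u.length) (o : Word) :
    (reader e c).ASteps D (2 * i) (conf u (.letter par false) (markCells j) 0 (tagged e []) o)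
      (conf u (.letter par (decide (j < i))) (markCells (if j < i then j + 1 else j)) i
        (tagged e (marked (u.take i) j)) o) := by
  induction i with
  | zero => simpa [marked] using .zero _
  | succ i ih =>
    refine ((ih (by omega)).succ (step_letter _ _ _ i hi _ _)).succ ?_
    have hm : tagged e (marked (u.take (i + 1)) j) =
        (tagged e (marked (u.take i) j) ++ [u[i]]) ++ [decide (i < j)] := by
      rw [List.take_succ_eq_append_getElem hi, marked_concat, List.length_take,
        min_eq_left (by omega)]
      simp [tagged]
    rw [hm]
    rcases lt_trichotomy i j with h | rfl | h
    · rw [if_neg (by omega), if_neg (by omega), decide_eq_false (show ¬ j < i by omega),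
        decide_eq_false (show ¬ j < i + 1 by omega), decide_eq_true h]
      exact step_marker_some par false j i h _ _
    · simp only [lt_irrefl, decide_false, if_false, Nat.lt_succ_self, decide_true, if_true]
      exact step_marker_new par i _ _
    · rw [if_pos (by omega), if_pos (by omega), decide_eq_true (show j < i by omega),
        decide_eq_true (show j < i + 1 by omega), decide_eq_false (show ¬ i < j by omega)]
      exact step_marker_none par (j + 1) i h _ _

theorem step_letter_end (par : Bool) (m : ℤ → Option Bool) (w o : Word) :
    (reader e c).AStep D (conf u (.letter par true) m u.length w o)
      (conf u (.ask par) m u.length w o) := by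
  refine Machine.astep_of_action _ rfl ?_
    ((apply_conf _ (.ask par) _ _ _ _ none none none rfl).trans (by simp))
  simp [reader, conf, inputCells_natCast]

open Classical in
theorem step_ask (par : Bool) (m : ℤ → Option Bool) (p : ℤ) (w o : Word) :
    (reader e c).AStep D (conf u (.ask par) m p w o)
      (conf u (.answer par (decide (w ∈ D))) m p [] o) := by
  by_cases h : w ∈ D
  · rw [decide_eq_true h]
    exact Or.inl ⟨h, rfl⟩
  · rw [decide_eq_false h]
    exact Or.inr ⟨h, rfl⟩

theorem step_answer (par ans : Bool) (m : ℤ → Option Bool) (i : ℕ) (o : Word) :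
    (reader e c).AStep D (conf u (.answer par ans) m i [] o)
      (conf u (.back par) m (i - 1) [] (o ++ if ans then [par] else [])) := by
  refine Machine.astep_of_action _ rfl rfl
    ((apply_conf _ (.back par) _ _ _ _ (some .left) none _ rfl).trans ?_)
  cases ans <;> simp [sub_eq_add_neg]

theorem asteps_back (par : Bool) (m : ℤ → Option Bool) (i : ℕ) (hi : i ≤ u.length) (o : Word) :
    (reader e c).ASteps D (i + 1) (conf u (.back par) m (i - 1) [] o)
      (conf u (.tag (!par) (Fin.last e)) m 0 [] o) := by
  induction i with
  | zero =>
    refine Machine.AStep.single (Machine.astep_of_action _ rfl ?_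
      ((apply_conf _ (.tag (!par) (Fin.last e)) _ _ _ _ (some .right) none none rfl).trans
        (by simp)))
    simp [reader, conf]
  | succ i ih =>
    refine Machine.AStep.head (Machine.astep_of_action _ rfl ?_
      ((apply_conf _ (.back par) _ _ _ _ (some .left) none none rfl).trans rfl)) ?_
    · have hv : inputCells u i = some u[i] := by
        rw [inputCells_natCast, List.getElem?_eq_getElem (by omega)]
      simp [reader, conf, hv]
    · simpa [sub_eq_add_neg] using ih (by omega)

open Classical in
theorem asteps_round (par : Bool) (j : ℕ) (hj : j < u.length) (o : Word) :
    (reader e c).ASteps D (e + 3 * u.length + 5)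
      (conf u (.tag par (Fin.last e)) (markCells j) 0 [] o)
      (conf u (.tag (!par) (Fin.last e)) (markCells (j + 1)) 0 []
        (o ++ if tagged e (marked u j) ∈ D then [par] else [])) := by
  have h₁ := asteps_tag (D := D) (c := c) (u := u) par e (Nat.lt_succ_self e) (markCells j) o
  have h₂ := asteps_scan (D := D) (e := e) (c := c) par j u.length le_rfl o
  rw [Nat.sub_self, List.replicate_zero] at h₁
  rw [decide_eq_true hj, if_pos hj, List.take_length] at h₂
  have h₃ := (((h₁.trans h₂).succ (step_letter_end _ _ _ _)).succ (step_ask _ _ _ _ _)).succ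
    (step_answer _ _ _ _ _)
  have h₄ := h₃.trans (asteps_back par _ u.length le_rfl _)
  have ht : e + 1 + 2 * u.length + 1 + 1 + 1 + (u.length + 1) = e + 3 * u.length + 5 := by omega
  rw [ht] at h₄
  simp only [decide_eq_true_eq] at h₄
  exact h₄

open Classical in
theorem asteps_rounds (j : ℕ) (hj : j ≤ u.length) :
    (reader e c).ASteps D (j * (e + 3 * u.length + 5))
      (conf u (.tag false (Fin.last e)) (markCells 0) 0 [] [])
      (conf u (.tag j.bodd (Fin.last e)) (markCells j) 0 []
        ((List.range j).flatMap fun j => if tagged e (marked u j) ∈ D then [j.bodd] else [])) := by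
  induction j with
  | zero => simpa using .zero _
  | succ j ih =>
    have := (ih (by omega)).trans (asteps_round j.bodd j hj _)
    rw [Nat.succ_mul, List.range_succ, List.flatMap_append, Nat.bodd_succ]
    simpa using this

theorem asteps_find (i : ℕ) (hi : i ≤ u.length) :
    (reader e c).ASteps D i (conf u .find (markCells 0) 0 [] [])
      (conf u .find (markCells 0) i [] []) := by
  induction i with
  | zero => exact .zero _
  | succ i ih =>
    refine (ih (by omega)).succ (Machine.astep_of_action _ rfl ?_
      ((apply_conf _ .find _ _ _ _ (some .right) none none rfl).trans (by simp)))
    have hv : inputCells u i = some u[i] := by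
      rw [inputCells_natCast, List.getElem?_eq_getElem (by omega)]
    simp [reader, conf, hv]

theorem step_find_end : (reader e c).AStep D (conf u .find (markCells 0) u.length [] [])
    (conf u (.extend (Fin.last c)) (markCells 0) u.length [] []) := by
  refine Machine.astep_of_action _ rfl ?_
    ((apply_conf _ (.extend (Fin.last c)) _ _ _ _ none none none rfl).trans (by simp))
  simp [reader, conf, inputCells_natCast]

theorem update_inputCells (u : Word) (b : Bool) :
    Function.update (inputCells u) u.length (some b) = inputCells (u ++ [b]) := by
  funext z
  rw [Function.update_apply]
  rcases lt_or_ge z 0 with h | h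
  · simp [inputCells, h]
    omega
  · lift z to ℕ using h
    simp only [inputCells_natCast, Nat.cast_inj]
    split_ifs with h
    · simp [h]
    · rw [List.getElem?_append]
      split_ifs with h'
      · rfl
      · rw [List.getElem?_eq_none (by omega), List.getElem?_eq_none (by simp; omega)]

theorem asteps_extend (l : ℕ) (h : l < c + 1) (u : Word) :
    (reader e c).ASteps D l (conf u (.extend ⟨l, h⟩) (markCells 0) u.length [] [])
      (conf (u ++ List.replicate l true) (.extend ⟨0, by omega⟩) (markCells 0)
        (u ++ List.replicate l true).length [] []) := by
  induction l generalizing u with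
  | zero => simpa using .zero _
  | succ l ih =>
    refine Machine.AStep.head (Machine.astep_of_action
      (B := conf (u ++ [true]) (.extend ⟨l, by omega⟩) (markCells 0) (u ++ [true]).length [] [])
      _ rfl rfl ?_) ?_
    · simp only [ACfg.apply, conf, ACfg.mk.injEq, true_and, Option.toList_none, List.append_nil,
        and_true]
      refine ⟨?_, by simp⟩
      funext i
      cases i
      · simp [update_inputCells]
      · simp [Function.update_eq_self]
    · have := ih (by omega) (u ++ [true])
      rwa [List.append_assoc, List.singleton_append, ← List.replicate_succ] at this

theorem step_extend_zero : (reader e c).AStep D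
    (conf u (.extend ⟨0, c.succ_pos⟩) (markCells 0) u.length [] [])
    (conf u (.back true) (markCells 0) (u.length - 1) [] []) :=
  Machine.astep_of_action _ rfl rfl
    ((apply_conf _ (.back true) _ _ _ _ (some .left) none none rfl).trans
      (by simp [sub_eq_add_neg]))

theorem exists_asteps (e c : ℕ) (D : Set Word) (v : Word) : ∃ t A,
    t ≤ 2 * (v.length + c) + 3 +
      (v.length + c + 1) * (e + 3 * (v.length + c) + 5) ∧
      (reader e c).ASteps D t ((reader e c).ainit v) A ∧
      (reader e c).AHalted A ∧ A.output = readOut e D (v ++ List.replicate c true) := by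
  have h₁ := (asteps_find (u := v) (D := D) (e := e) (c := c) v.length le_rfl).succ step_find_end
  have h₂ := h₁.trans (asteps_extend c c.lt_succ_self v)
  have hu : (v ++ List.replicate c true).length = v.length + c := by simp
  generalize v ++ List.replicate c true = u at h₂ hu ⊢
  have h₃ := (h₂.succ step_extend_zero).trans
    (asteps_back true (markCells 0) u.length le_rfl [])
  have h₄ := h₃.trans (asteps_rounds (D := D) (e := e) (c := c) (u := u) u.length le_rfl)
  have h₅ := asteps_tag (D := D) (c := c) (u := u) u.length.bodd e (Nat.lt_succ_self e)
    (markCells u.length) (readOut e D u)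
  have h₆ := asteps_scan (D := D) (e := e) (c := c) u.length.bodd u.length u.length le_rfl
    (readOut e D u)
  rw [Nat.sub_self, List.replicate_zero] at h₅
  refine ⟨_, _, ?_, ainit_eq ▸ ((h₄.trans h₅).trans h₆), ⟨rfl, ?_⟩, rfl⟩
  · rw [hu, add_one_mul (v.length + c)]
    omega
  · simp [reader, conf, inputCells_natCast]

end reader

/-- The function that `reader e c` computes with oracle `D`. -/
noncomputable def readFn (e c : ℕ) (D : Set Word) (v : Word) : Word :=
  readOut e D (v ++ List.replicate c true)

theorem readFn_mem_classFP (e c : ℕ) (O : Set Word) : readFn e c O ∈ classFP O := by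
  refine Machine.mem_classFP (reader.deterministic e c)
    (2 * (.X + .C c) + 3 + (.X + .C c + 1) * (.C e + 3 * (.X + .C c) + 5)) (readFn e c)
    (fun D u => ?_) O
  obtain ⟨t, A, ht, h⟩ := reader.exists_asteps e c D u
  exact ⟨t, A, by simpa using ht, h⟩

/-! ### A machine that pads its input polynomially -/

/-- The word `x` with each letter preceded by `1`. -/
def doubled : Word → Word
  | [] => []
  | b :: x => true :: b :: doubled x

/-- The word that codes the number `i`, the word `x` and `r` letters of padding. -/
def padded (i : ℕ) (x : Word) (r : ℕ) : Word :=
  tagged i (doubled x ++ false :: List.replicate r true)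

theorem doubled_append (x y : Word) : doubled (x ++ y) = doubled x ++ doubled y := by
  induction x with
  | nil => rfl
  | cons b x ih => simp [doubled, ih]

@[simp] theorem length_doubled (x : Word) : (doubled x).length = 2 * x.length := by
  induction x with
  | nil => rfl
  | cons b x ih => simp [doubled, ih]; omega

@[simp] theorem length_padded (i : ℕ) (x : Word) (r : ℕ) :
    (padded i x r).length = i + 2 * x.length + r + 2 := by
  simp [padded]
  omega

theorem padded_inj {i i' r r' : ℕ} {x x' : Word} :
    padded i x r = padded i' x' r' ↔ i = i' ∧ x = x' ∧ r = r' := by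
  refine ⟨fun h => ?_, fun ⟨h, h', h''⟩ => h ▸ h' ▸ h'' ▸ rfl⟩
  obtain ⟨hi, h'⟩ := tagged_inj.1 h
  refine ⟨hi, ?_⟩
  clear h hi
  rename' h' => h
  induction x generalizing x' with
  | nil =>
    cases x' with
    | nil => simpa [doubled] using h
    | cons b x' => simp [doubled] at h
  | cons b x ih =>
    cases x' with
    | nil => simp [doubled] at h
    | cons b' x' =>
      simp only [doubled, List.cons_append, List.cons.injEq, true_and] at h
      obtain ⟨h₁, h₂⟩ := ih h.2
      exact ⟨by rw [h.1, h₁], h₂⟩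

/-- Subtracting one from a number in base `M + 1`. -/
theorem sum_digits_pred {K : ℕ} (M : ℕ) {a a' : Fin K → ℕ} (r : Fin K)
    (hlt : ∀ s < r, a s = 0 ∧ a' s = M) (hr : a r = a' r + 1) (hgt : ∀ s, r < s → a s = a' s) :
    ∑ s, a s * (M + 1) ^ (s : ℕ) = ∑ s, a' s * (M + 1) ^ (s : ℕ) + 1 := by
  induction K with
  | zero => exact r.elim0
  | succ K ih =>
    simp only [Fin.sum_univ_succ, Fin.val_zero, pow_zero, mul_one, Fin.val_succ, pow_succ,
      ← mul_assoc, ← Finset.sum_mul]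
    induction r using Fin.cases with
    | zero =>
      have : ∀ s : Fin K, a s.succ = a' s.succ := fun s => hgt _ (Fin.succ_pos s)
      simp only [this, hr]
      ring
    | succ r =>
      have h := ih (a := fun s => a s.succ) (a' := fun s => a' s.succ) r
        (fun s hs => hlt _ (Fin.succ_lt_succ_iff.2 hs)) hr
        (fun s hs => hgt _ (Fin.succ_lt_succ_iff.2 hs))
      obtain ⟨h₁, h₂⟩ := hlt 0 (Fin.succ_pos r)
      rw [h, h₁, h₂]
      ring

theorem sum_digits_max (K M : ℕ) : ∑ s : Fin K, M * (M + 1) ^ (s : ℕ) + 1 = (M + 1) ^ K := by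
  induction K with
  | zero => simp
  | succ K ih =>
    rw [Fin.sum_univ_castSucc]
    simp only [Fin.val_castSucc, Fin.val_last]
    rw [pow_succ, ← ih]
    ring

/-- The states of the machine `padder i K`. -/
inductive PadState (i K : ℕ)
  | tag (l : Fin (i + 1))
  | mark
  | letter
  | tick (d : Fin K → Bool)

instance (i K : ℕ) : Finite (PadState i K) :=
  Finite.of_injective
    (fun q : PadState i K => match q with
      | .tag l => (Sum.inl l : Fin (i + 1) ⊕ (Fin 2 ⊕ (Fin K → Bool)))
      | .mark => .inr (.inl 0)
      | .letter => .inr (.inl 1)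
      | .tick d => .inr (.inr d))
    (by intro a b h; cases a <;> cases b <;> simp_all)

/-- The machine that on input `x` outputs `i` and `x`, followed by `(x.length + 2) ^ K - 1` letters
of padding. Besides the input tape `none` it has `K` tapes with `x.length + 2` cells each, the
outermost of which are marked by `1` on the left and by `0` on the right. In the state `tick d`, the
heads on these tapes run through all combinations of positions, in the order of a reflected Gray
code: `d r` tells whether head `r` is moving left, and a head turns around when a higher one
moves. -/
def padder (i K : ℕ) : Machine (Option (Fin K)) (PadState i K) where
  start := .tag (Fin.last i)
  accept := ∅
  inputTape := none
  ask _ := none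
  trans q s :=
    match q with
    | .tag ⟨l + 1, h⟩ => {⟨.tag ⟨l, by omega⟩, s, fun _ => none, none, some true⟩}
    | .tag ⟨0, _⟩ => {⟨.mark, fun t => t.elim (s none) fun _ => some true,
        fun t => t.elim none fun _ => some .right, none, some false⟩}
    | .mark =>
      match s none with
      | some _ => {⟨.letter, s, fun _ => none, none, some true⟩}
      | none => {⟨.tick fun _ => true, fun t => t.elim (s none) fun _ => some false,
          fun _ => none, none, some false⟩}
    | .letter =>
      match s none with
      | some b => {⟨.mark, s, fun _ => some .right, none, some b⟩}
      | none => ∅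
    | .tick d =>
      {a | ∃ r, s (some r) ≠ some (d r) ∧ (∀ r' < r, s (some r') = some (d r')) ∧
        a = ⟨.tick fun r' => if r' < r then !d r' else d r', s,
          fun t => t.elim none fun r' =>
            if r' = r then some (if d r then .left else .right) else none,
          none, some true⟩}

namespace padder

variable {i K : ℕ} {x : Word} {D : Set Word}

theorem deterministic (i K : ℕ) : (padder i K).Deterministic := by
  intro q s
  unfold padder
  dsimp only
  split <;> (try split) <;>
    first | exact Set.subsingleton_singleton | exact Set.subsingleton_empty | skip
  rintro _ ⟨r, h₁, h₂, rfl⟩ _ ⟨r', h₁', h₂', rfl⟩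
  obtain rfl : r = r' := by
    rcases lt_trichotomy r r' with h | h | h
    · exact absurd (h₂' r h) h₁
    · exact h
    · exact absurd (h₂ r' h) h₁'
  rfl

/-- The configurations of `padder i K` on input `x`. All the tapes but the input tape have the same
contents. -/
def conf (x : Word) (q : PadState i K) (m : ℤ → Option Bool) (p₀ : ℤ) (p : Fin K → ℤ) (o : Word) :
    ACfg (Option (Fin K)) (PadState i K) :=
  ⟨q, fun t => t.elim (inputCells x) fun _ => m, fun t => t.elim p₀ p, [], o⟩

theorem ainit_eq : (padder i K).ainit x =
    conf x (.tag (Fin.last i)) (fun _ => none) 0 (fun _ => 0) [] := by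
  simp only [Machine.ainit, conf, padder, ACfg.mk.injEq, true_and, and_true]
  constructor
  · funext t z
    cases t <;> simp
  · funext t
    cases t <;> simp

theorem apply_conf (q q' : PadState i K) (m : ℤ → Option Bool) (p₀ : ℤ) (p p' : Fin K → ℤ)
    (o : Word) (d₀ : Option Turing.Dir) (d : Fin K → Option Turing.Dir) (b : Option Bool)
    {s : Option (Fin K) → Option Bool}
    (hs : s = fun t => (t.elim (inputCells x) fun _ => m) (t.elim p₀ p))
    {dd : Option (Fin K) → Option Turing.Dir} (hdd : dd = fun t => t.elim d₀ d)
    (hp : ∀ r, p' r = p r + shift (d r)) :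
    (conf x q m p₀ p o).apply ⟨q', s, dd, none, b⟩ =
      conf x q' m (p₀ + shift d₀) p' (o ++ b.toList) := by
  subst hs
  subst hdd
  obtain rfl : p' = fun r => p r + shift (d r) := funext hp
  simp only [ACfg.apply, conf, Function.update_eq_self, Option.toList_none, List.append_nil,
    ACfg.mk.injEq, true_and, and_true]
  funext t
  cases t <;> simp

theorem asteps_tag (l : ℕ) (h : l < i + 1) :
    (padder i K).ASteps D (l + 1)
      (conf x (.tag ⟨l, h⟩) (fun _ => none) 0 (fun _ => 0) (List.replicate (i - l) true))
      (conf x .mark (Function.update (fun _ => none) 0 (some true)) 0 (fun _ => 1)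
        (tagged i [])) := by
  induction l with
  | zero =>
    refine (Machine.astep_of_action _ rfl rfl ?_).single
    simp only [ACfg.apply, conf, ACfg.mk.injEq, true_and]
    refine ⟨?_, ?_, rfl, rfl⟩ <;>
    · funext t
      cases t <;> simp [Function.update_eq_self]
  | succ l ih =>
    refine (Machine.astep_of_action _ rfl rfl ((apply_conf _ _ _ _ _ (fun _ => 0) _ none
      (fun _ => none) (some true) rfl (by funext t; cases t <;> rfl) (by simp)))).head ?_
    have hr : List.replicate (i - (l + 1)) true ++ (some true).toList =
        List.replicate (i - l) true := by
      rw [show i - l = i - (l + 1) + 1 by omega, List.replicate_succ']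
      rfl
    rw [hr]
    exact ih (by omega)

theorem asteps_scan (m : ℤ → Option Bool) (j : ℕ) (hj : j ≤ x.length) :
    (padder i K).ASteps D (2 * j) (conf x .mark m 0 (fun _ => 1) (tagged i []))
      (conf x .mark m j (fun _ => j + 1) (tagged i (doubled (x.take j)))) := by
  induction j with
  | zero => simpa [doubled] using .zero _
  | succ j ih =>
    have hv : inputCells x j = some x[j] := by
      rw [inputCells_natCast, List.getElem?_eq_getElem (by omega)]
    have h₁ : (padder i K).AStep D
        (conf x .mark m j (fun _ => j + 1) (tagged i (doubled (x.take j))))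
        (conf x .letter m j (fun _ => j + 1) (tagged i (doubled (x.take j)) ++ [true])) := by
      refine Machine.astep_of_action _ rfl ?_ ((apply_conf _ .letter _ _ _ (fun _ => j + 1) _ none
        (fun _ => none) (some true) rfl rfl (by simp)).trans (by simp))
      simp only [padder, conf, Option.elim_none, hv, Set.mem_singleton_iff, Action.mk.injEq,
        true_and, and_true]
      funext t
      cases t <;> rfl
    have h₂ : (padder i K).AStep D
        (conf x .letter m j (fun _ => j + 1) (tagged i (doubled (x.take j)) ++ [true]))
        (conf x .mark m (j + 1 : ℕ) (fun _ => (j + 1 : ℕ) + 1)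
          (tagged i (doubled (x.take (j + 1))))) := by
      refine Machine.astep_of_action _ rfl ?_ ((apply_conf _ .mark _ _ _
        (fun _ => (j + 1 : ℕ) + 1) _ (some .right)
        (fun _ => some .right) (some x[j]) rfl rfl (by simp)).trans ?_)
      · simp only [padder, conf, Option.elim_none, hv, Set.mem_singleton_iff, Action.mk.injEq,
          true_and, and_true]
        funext t
        cases t <;> rfl
      · rw [List.take_succ_eq_append_getElem hj, doubled_append]
        simp [tagged, doubled]
    exact ((ih (by omega)).succ h₁).succ h₂

/-- The contents of the additional tapes during the counting. -/
def counterCells (n : ℕ) : ℤ → Option Bool :=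
  Function.update (Function.update (fun _ => none) 0 (some true)) (n + 1) (some false)

theorem step_mark_end (o : Word) :
    (padder i K).AStep D
      (conf x .mark (Function.update (fun _ => none) 0 (some true)) x.length
        (fun _ => x.length + 1) o)
      (conf x (.tick fun _ => true) (counterCells x.length) x.length
        (fun _ => x.length + 1) (o ++ [false])) := by
  refine Machine.astep_of_action ⟨.tick fun _ => true,
    fun t => t.elim (inputCells x x.length) fun _ => some false,
    fun _ => none, none, some false⟩ rfl ?_ ?_
  · have hv : inputCells x x.length = none := by
      rw [inputCells_natCast, List.getElem?_length]
    simp [padder, conf, hv]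
  · simp only [ACfg.apply, conf, ACfg.mk.injEq, true_and, shift_none, add_zero,
      Option.toList_none, List.append_nil, Option.toList_some, and_true]
    funext t
    cases t <;> simp [counterCells]

/-- The distance of a head at position `p` on a tape with positions `0, …, M` to the end it is
heading for. -/
def dist (M : ℕ) (d : Bool) (p : ℕ) : ℕ := if d then p else M - p

theorem counterCells_eq_iff {n p : ℕ} (d : Bool) (hp : p ≤ n + 1) :
    counterCells n p = some d ↔ dist (n + 1) d p = 0 := by
  unfold counterCells dist
  rw [Function.update_apply, Function.update_apply]
  cases d <;> split_ifs <;> simp_all <;> omega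

theorem asteps_tick (V : ℕ) (d : Fin K → Bool) (p : Fin K → ℕ) (hp : ∀ r, p r ≤ x.length + 1)
    (hV : V = ∑ r, dist (x.length + 1) (d r) (p r) * (x.length + 1 + 1) ^ (r : ℕ)) (p₀ : ℤ)
    (o : Word) :
    ∃ A, (padder i K).ASteps D V
      (conf x (.tick d) (counterCells x.length) p₀ (fun r => p r) o) A ∧
      (padder i K).AHalted A ∧ A.output = o ++ List.replicate V true := by
  induction V generalizing d p o with
  | zero =>
    refine ⟨_, .zero _, ⟨rfl, ?_⟩, by simp [conf]⟩
    rw [Set.eq_empty_iff_forall_notMem]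
    rintro a ⟨r, hr, -⟩
    refine hr ((counterCells_eq_iff _ (hp r)).2 ?_)
    have := (Finset.sum_eq_zero_iff.1 hV.symm) r (Finset.mem_univ r)
    simpa using this
  | succ V ih =>
    -- the lowest head that has not reached its end moves on, and the heads below it turn around
    obtain ⟨r, hr, hmin⟩ : ∃ r, dist (x.length + 1) (d r) (p r) ≠ 0 ∧
        ∀ r' < r, dist (x.length + 1) (d r') (p r') = 0 := by
      have hne : {r | dist (x.length + 1) (d r) (p r) ≠ 0}.Nonempty := by
        by_contra hne
        rw [Set.not_nonempty_iff_eq_empty, Set.eq_empty_iff_forall_notMem] at hne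
        have : ∀ r, dist (x.length + 1) (d r) (p r) = 0 := fun r => not_not.1 (hne r)
        simp [this] at hV
      obtain ⟨r, hr, hmin⟩ := wellFounded_lt.has_min _ hne
      exact ⟨r, hr, fun r' h => by_contra fun h' => hmin r' h' h⟩
    let p' : Fin K → ℕ := fun r' => if r' = r then (if d r then p r - 1 else p r + 1) else p r'
    let d' : Fin K → Bool := fun r' => if r' < r then !d r' else d r'
    have hpr := hp r
    have hp' : ∀ r, p' r ≤ x.length + 1 := by
      intro r'
      have := hp r'
      unfold dist at hr
      simp only [p']
      split_ifs at hr ⊢ <;> omega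
    have hV' : V = ∑ r, dist (x.length + 1) (d' r) (p' r) * (x.length + 1 + 1) ^ (r : ℕ) := by
      have := sum_digits_pred (x.length + 1) (a := fun r => dist (x.length + 1) (d r) (p r))
        (a' := fun r => dist (x.length + 1) (d' r) (p' r)) r
        (fun s hs => ⟨hmin s hs, ?_⟩) ?_ (fun s hs => ?_)
      · omega
      · have h₁ := hmin s hs
        have h₂ := hp s
        simp only [d', p', hs, hs.ne, if_true, if_false]
        unfold dist at h₁ ⊢
        cases hd : d s <;> simp [hd] at h₁ ⊢ <;> omega
      · simp only [d', p', lt_irrefl, if_true, if_false]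
        unfold dist at hr ⊢
        cases hd : d r <;> simp [hd] at hr ⊢ <;> omega
      · simp [d', p', hs.not_gt, hs.ne']
    obtain ⟨A, hA, hA'⟩ := ih d' p' hp' hV' (o ++ [true])
    refine ⟨A, Machine.AStep.head (Machine.astep_of_action ⟨.tick d', _, _, none, some true⟩ rfl
      ⟨r, ?_, ?_, rfl⟩ ((apply_conf _ _ _ _ _ (fun r => p' r) _ none
        (fun r' => if r' = r then some (if d r then .left else .right) else none) _ rfl rfl
          ?_).trans ?_)) hA, hA'.1, ?_⟩
    · exact fun h => hr ((counterCells_eq_iff _ (hp r)).1 h)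
    · exact fun r' h => (counterCells_eq_iff _ (hp r')).2 (hmin r' h)
    · intro r'
      simp only [p']
      by_cases h : r' = r
      · subst h
        unfold dist at hr
        cases hd : d r' <;> simp [hd] at hr ⊢
        omega
      · simp [h]
    · simp
    · rw [hA'.2, List.append_assoc, List.replicate_succ]
      rfl

theorem exists_asteps (i K : ℕ) (D : Set Word) (x : Word) : ∃ t A,
    t ≤ i + 2 * x.length + 2 + (x.length + 2) ^ K ∧
      (padder i K).ASteps D t ((padder i K).ainit x) A ∧ (padder i K).AHalted A ∧
      A.output = padded i x ((x.length + 2) ^ K - 1) := by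
  have h₁ := asteps_tag (K := K) (x := x) (D := D) i (Nat.lt_succ_self i)
  rw [Nat.sub_self, List.replicate_zero] at h₁
  have h₂ := asteps_scan (i := i) (K := K) (x := x) (D := D)
    (Function.update (fun _ => none) 0 (some true)) x.length le_rfl
  rw [List.take_length] at h₂
  have hsum := sum_digits_max K (x.length + 1)
  change _ = (x.length + 2) ^ K at hsum
  obtain ⟨A, hA, hA', hout⟩ := asteps_tick (i := i) (K := K) (x := x) (D := D)
    ((x.length + 2) ^ K - 1) (fun _ => true) (fun _ => x.length + 1) (fun _ => le_rfl)
    (by simp only [dist, if_true]; omega) x.length (tagged i (doubled x) ++ [false])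
  rw [ainit_eq]
  have h₃ := (h₁.trans h₂).succ (step_mark_end _)
  refine ⟨_, A, ?_, h₃.trans (by exact_mod_cast hA), hA', ?_⟩
  · omega
  · rw [hout]
    simp [padded, tagged]

end padder

/-- The function that `padder i K` computes. -/
def padFn (i K : ℕ) (x : Word) : Word := padded i x ((x.length + 2) ^ K - 1)

theorem padFn_mem_classFP (i K : ℕ) (O : Set Word) : padFn i K ∈ classFP O := by
  refine Machine.mem_classFP (padder.deterministic i K) (.C i + 2 * .X + 2 + (.X + 2) ^ K)
    (fun _ => padFn i K) (fun D x => ?_) O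
  obtain ⟨t, A, ht, h⟩ := padder.exists_asteps i K D x
  exact ⟨t, A, by simpa using ht, h⟩

/-! ### Runs guided by a sequence of instructions -/

namespace Machine

variable {K Q : Type} {M : Machine K Q} {D D' : Set Word}

open Classical in
/-- The configuration after one step, in which the instruction `a` is executed if it is available,
and some available instruction otherwise. A halting configuration does not change. -/
noncomputable def next (M : Machine K Q) (D : Set Word) (a : Action K Q) (c : Cfg K Q) : Cfg K Q :=
  match M.ask c.state with
  | some (y, n) =>
    if c.query ∈ D then { c with state := y, query := [] } else { c with state := n, query := [] }
  | none =>
    if a ∈ M.trans c.state (fun i => (c.tape i).head) then c.apply a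
    else if h : (M.trans c.state (fun i => (c.tape i).head)).Nonempty then c.apply h.some
    else c

/-- The configuration after `t` steps that prefer the instructions `ch 0, ch 1, …`; the run stops
early in a halting configuration. -/
noncomputable def run (M : Machine K Q) (D : Set Word) (ch : ℕ → Action K Q) (c : Cfg K Q) :
    ℕ → Cfg K Q
  | 0 => c
  | t + 1 => M.next D (ch t) (run M D ch c t)

theorem step_next {c : Cfg K Q} (a : Action K Q) (h : ¬ M.Halted D c) :
    M.Step D c (M.next D a c) := by
  rw [halted_iff] at h
  unfold Step next
  rcases hq : M.ask c.state with _ | ⟨y, n⟩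
  · simp only [hq, true_and] at h ⊢
    split_ifs with h₁ h₂
    · exact ⟨_, h₁, rfl⟩
    · exact ⟨_, h₂.some_mem, rfl⟩
    · exact (h (Set.not_nonempty_iff_eq_empty.1 h₂)).elim
  · simp only
    split_ifs with h₁
    · exact Or.inl ⟨h₁, rfl⟩
    · exact Or.inr ⟨h₁, rfl⟩

theorem next_of_halted {c : Cfg K Q} (a : Action K Q) (h : M.Halted D c) :
    M.next D a c = c := by
  obtain ⟨h₁, h₂⟩ := halted_iff.1 h
  unfold next
  simp [h₁, h₂]

theorem exists_steps_run (ch : ℕ → Action K Q) (c : Cfg K Q) (t : ℕ) :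
    ∃ s ≤ t, M.Steps D s c (M.run D ch c t) ∧ (s = t ∨ M.Halted D (M.run D ch c t)) := by
  induction t with
  | zero => exact ⟨0, le_rfl, .zero c, Or.inl rfl⟩
  | succ t ih =>
    obtain ⟨s, hs, h, h'⟩ := ih
    by_cases hh : M.Halted D (M.run D ch c t)
    · refine ⟨s, by omega, ?_⟩
      rw [run, next_of_halted _ hh]
      exact ⟨h, Or.inr hh⟩
    · obtain rfl := h'.resolve_right hh
      exact ⟨s + 1, le_rfl, h.succ (step_next _ hh), Or.inl rfl⟩

theorem run_of_halted {ch : ℕ → Action K Q} {c : Cfg K Q} {s t : ℕ} (hst : s ≤ t)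
    (h : M.Halted D (M.run D ch c s)) : M.run D ch c t = M.run D ch c s := by
  induction t, hst using Nat.le_induction with
  | base => rfl
  | succ t _ ih => rw [run, ih, next_of_halted _ h]

theorem Deterministic.run_eq (hM : M.Deterministic) (ch : ℕ → Action K Q) {t : ℕ}
    {c c' : Cfg K Q} (h : M.Steps D t c c') : M.run D ch c t = c' := by
  induction h with
  | zero => rfl
  | succ h h' ih =>
    rw [run, ih]
    exact hM.step_unique (step_next _ fun hh => hh _ h') h'

/-- Every computation path is the run guided by its own instructions. -/
theorem Steps.exists_run {t : ℕ} {c c' : Cfg K Q} (h : M.Steps D t c c') :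
    ∃ acts : ℕ → Action K Q, ∀ ch : ℕ → Action K Q, (∀ s < t, ch s = acts s) →
      M.run D ch c t = c' := by
  induction h with
  | zero => exact ⟨fun _ => ⟨M.start, fun _ => none, fun _ => none, none, none⟩, fun _ _ => rfl⟩
  | @succ t a b c h h' ih =>
    obtain ⟨acts, hacts⟩ := ih
    have key : ∃ α : Action K Q, M.next D α b = c := by
      unfold Step at h'
      unfold next
      rcases hq : M.ask b.state with _ | ⟨y, n⟩
      · simp only [hq] at h' ⊢
        obtain ⟨α, hα, rfl⟩ := h'
        exact ⟨α, if_pos hα⟩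
      · simp only [hq] at h' ⊢
        refine ⟨acts 0, ?_⟩
        rcases h' with ⟨h', rfl⟩ | ⟨h', rfl⟩
        · exact if_pos h'
        · exact if_neg h'
    obtain ⟨α, hα⟩ := key
    refine ⟨Function.update acts t α, fun ch hch => ?_⟩
    rw [run, hacts ch, hch t (Nat.lt_succ_self t), Function.update_self, hα]
    intro s hs
    rw [hch s (by omega), Function.update_of_ne hs.ne]

theorem next_congr {c : Cfg K Q} (a : Action K Q) (h : c.query ∈ D ↔ c.query ∈ D') :
    M.next D a c = M.next D' a c := by
  rcases hq : M.ask c.state with _ | ⟨y, n⟩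
  · simp only [next, hq]
  · simp only [next, hq]
    by_cases h' : c.query ∈ D
    · rw [if_pos h', if_pos (h.1 h')]
    · rw [if_neg h', if_neg (mt h.2 h')]

theorem next_query_length_le (a : Action K Q) (c : Cfg K Q) :
    (M.next D a c).query.length ≤ c.query.length + 1 := by
  by_cases h : M.Halted D c
  · rw [next_of_halted a h]
    omega
  · exact (step_next a h).query_length_le

/-- A run depends only on the answers to the queries that occur in it, and it takes at least as many
steps to write these queries as they have letters. -/
theorem exists_queries (M : Machine K Q) (D : Set Word) (ch : ℕ → Action K Q) (c : Cfg K Q)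
    (t : ℕ) : ∃ ql : List Word,
      (ql.map List.length).sum + (M.run D ch c t).query.length ≤ c.query.length + t ∧
      ∀ D' : Set Word, (∀ q ∈ ql, q ∈ D ↔ q ∈ D') → M.run D' ch c t = M.run D ch c t := by
  induction t with
  | zero => exact ⟨[], by simp [run], fun _ _ => rfl⟩
  | succ t ih =>
    obtain ⟨ql, hlen, hql⟩ := ih
    rcases hq : M.ask (M.run D ch c t).state with _ | ⟨y, n⟩
    · refine ⟨ql, ?_, fun D' hD' => ?_⟩
      · have := M.next_query_length_le (D := D) (ch t) (M.run D ch c t)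
        rw [run]
        omega
      · rw [run, run, hql D' hD']
        simp only [next, hq]
    · refine ⟨ql ++ [(M.run D ch c t).query], ?_, fun D' hD' => ?_⟩
      · have : (M.run D ch c (t + 1)).query = [] := by
          simp only [run, next, hq]
          split_ifs <;> rfl
        rw [this]
        simp
        omega
      · rw [run, run, hql D' fun q hq => hD' q (by simp [hq])]
        exact (next_congr _ (hD' _ (by simp))).symm

theorem run_congr {ch : ℕ → Action K Q} {x : Word} {t : ℕ}
    (h : ∀ w : Word, w.length ≤ t → (w ∈ D ↔ w ∈ D')) :
    M.run D' ch (M.init x) t = M.run D ch (M.init x) t := by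
  obtain ⟨ql, hlen, hql⟩ := M.exists_queries D ch (M.init x) t
  refine hql D' fun q hq => h q ?_
  have := List.single_le_sum (by simp) _ (List.mem_map_of_mem (f := List.length) hq)
  simp only [init, List.length_nil, zero_add] at hlen
  exact this.trans ((Nat.le_add_right _ _).trans hlen)

end Machine

/-! ### An enumeration of the polynomial-time machines -/

/-- The data that determine a set `A` in `NP^O` or `coNP^O` and an element of it: a polynomial-time
machine that accepts `A` or its complement, a bit that tells which, and the element. -/
structure Index where
  k : ℕ
  n : ℕ
  M : Machine (Fin k) (Fin n)
  polyTime : M.PolyTime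
  pol : Bool
  dflt : Word

instance : Finite Turing.Dir :=
  Finite.of_injective (fun d : Turing.Dir => match d with | .left => true | .right => false)
    (by intro a b h; cases a <;> cases b <;> simp_all)

instance (k n : ℕ) : Finite (Action (Fin k) (Fin n)) :=
  Finite.of_injective (fun a : Action (Fin k) (Fin n) => (a.next, a.write, a.move, a.query,
    a.output)) (by rintro ⟨⟩ ⟨⟩ h; simp_all)

instance (k n : ℕ) : Finite (Machine (Fin k) (Fin n)) :=
  Finite.of_injective (fun M : Machine (Fin k) (Fin n) => (M.start, M.accept, M.inputTape, M.ask,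
    M.trans)) (by rintro ⟨⟩ ⟨⟩ h; simp_all)

instance : Countable Index :=
  Function.Injective.countable
    (f := fun i : Index => ((⟨i.k, i.n, i.M⟩ : Σ k n, Machine (Fin k) (Fin n)), i.pol, i.dflt))
    (by
      rintro ⟨k, n, M, hM, b, w⟩ ⟨k', n', M', hM', b', w'⟩ h
      simp only [Prod.mk.injEq, Sigma.mk.injEq] at h
      obtain ⟨⟨rfl, h⟩, rfl, rfl⟩ := h
      obtain ⟨rfl, h⟩ := Sigma.mk.injEq .. ▸ eq_of_heq h
      obtain rfl := eq_of_heq h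
      rfl)

instance : Nonempty Index := by
  obtain ⟨k, n, N, hN, -⟩ := guessSet_mem_classNP 0 ∅
  exact ⟨⟨k, n, N, hN, true, []⟩⟩

/-- An enumeration of all indices. -/
noncomputable def idx : ℕ → Index := (exists_surjective_nat Index).choose

theorem idx_surjective : Function.Surjective idx := (exists_surjective_nat Index).choose_spec

/-- A polynomial time bound for the machine with number `e`. -/
noncomputable def bound (e : ℕ) : Polynomial ℕ := (idx e).polyTime.choose

theorem le_bound {e : ℕ} {D : Set Word} {x : Word} {t : ℕ}
    {c : Cfg (Fin (idx e).k) (Fin (idx e).n)}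
    (h : (idx e).M.Steps D t ((idx e).M.init x) c) : t ≤ (bound e).eval x.length :=
  (idx e).polyTime.choose_spec D x t c h

theorem exists_enum (α : Type) [Finite α] [Nonempty α] :
    ∃ (N : ℕ) (E : ℕ → α), ∀ a, ∃ i ≤ N, E i = a := by
  obtain ⟨n, ⟨f⟩⟩ := Finite.exists_equiv_fin α
  refine ⟨n, fun i => if h : i < n then f.symm ⟨i, h⟩ else Classical.arbitrary α, fun a =>
    ⟨f a, (f a).2.le, by simp⟩⟩

instance (e : ℕ) : Nonempty (Action (Fin (idx e).k) (Fin (idx e).n)) :=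
  ⟨⟨(idx e).M.start, fun _ => none, fun _ => none, none, none⟩⟩

/-- The length of the code of an instruction of the machine with number `e`. -/
noncomputable def width (e : ℕ) : ℕ :=
  (exists_enum (Action (Fin (idx e).k) (Fin (idx e).n))).choose

/-- An enumeration of the instructions of the machine with number `e`. -/
noncomputable def enumAction (e : ℕ) : ℕ → Action (Fin (idx e).k) (Fin (idx e).n) :=
  (exists_enum (Action (Fin (idx e).k) (Fin (idx e).n))).choose_spec.choose

theorem exists_enumAction (e : ℕ) (a : Action (Fin (idx e).k) (Fin (idx e).n)) :
    ∃ i ≤ width e, enumAction e i = a :=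
  (exists_enum (Action (Fin (idx e).k) (Fin (idx e).n))).choose_spec.choose_spec a

/-- The sequence of instructions that the word `z` codes: it consists of blocks of length
`width e`, each of which codes a number by its number of ones. -/
noncomputable def guided (e : ℕ) (z : Word) (s : ℕ) : Action (Fin (idx e).k) (Fin (idx e).n) :=
  enumAction e (((z.drop (width e * s)).take (width e)).count true)

theorem exists_guided (e : ℕ) (acts : ℕ → Action (Fin (idx e).k) (Fin (idx e).n)) (T : ℕ) :
    ∃ z : Word, z.length = width e * T ∧
      ∀ z' : Word, ∀ s < T, guided e (z ++ z') s = acts s := by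
  induction T with
  | zero => exact ⟨[], by simp, by simp⟩
  | succ T ih =>
    obtain ⟨z, hz, h⟩ := ih
    obtain ⟨i, hi, hi'⟩ := exists_enumAction e (acts T)
    refine ⟨z ++ (List.replicate i true ++ List.replicate (width e - i) false), ?_,
      fun z' s hs => ?_⟩
    · simp [hz]
      rw [Nat.mul_succ]
      omega
    · rcases Nat.lt_succ_iff_lt_or_eq.1 hs with hs | rfl
      · rw [List.append_assoc]
        exact h _ s hs
      · have h₁ : (List.replicate i true ++ List.replicate (width e - i) false).length =
            width e := by
          simp
          omega
        rw [guided, List.append_assoc, ← hz, List.drop_left, List.take_left' h₁, ← hi']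
        simp [List.count_replicate]

/-! ### Self-referential oracles -/

/-- The two sets contain the same words of length at most `m`. -/
def Agree (m : ℕ) (D D' : Set Word) : Prop := ∀ w : Word, w.length ≤ m → (w ∈ D ↔ w ∈ D')

theorem Agree.mono {m n : ℕ} {D D' : Set Word} (h : Agree m D D') (hn : n ≤ m) :
    Agree n D D' :=
  fun w hw => h w (hw.trans hn)

/-- A set can be defined by a condition on each word that refers to the shorter words of the
set. -/
theorem exists_fixpoint (Ψ : Word → Set Word → Prop)
    (hΨ : ∀ w D D', (∀ v : Word, v.length < w.length → (v ∈ D ↔ v ∈ D')) → (Ψ w D ↔ Ψ w D')) :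
    ∃ O : Set Word, ∀ w, w ∈ O ↔ Ψ w O := by
  let A : ℕ → Set Word := fun n => Nat.rec ∅ (fun _ B => {w | Ψ w B}) n
  have hA : ∀ n w, w ∈ A (n + 1) ↔ Ψ w (A n) := fun n w => Iff.rfl
  have key : ∀ n m, n ≤ m → ∀ w : Word, w.length < n → (w ∈ A n ↔ w ∈ A m) := by
    intro n
    induction n with
    | zero => simp
    | succ n ih =>
      intro m hm w hw
      obtain ⟨m, rfl⟩ := Nat.exists_eq_add_of_lt hm
      rw [hA, hA]
      exact hΨ _ _ _ fun v hv => ih _ (by omega) v (by omega)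
  refine ⟨{w | w ∈ A (w.length + 1)}, fun w => (hA _ w).trans (hΨ _ _ _ fun v hv => ?_)⟩
  exact (key (v.length + 1) w.length hv v (by omega)).symm

/-! ### The oracle -/

/-- The configuration that the machine with number `e` reaches on input `x` with oracle `D` after
`t` steps, guided by `z`. -/
noncomputable def final (e : ℕ) (z : Word) (D : Set Word) (x : Word) (t : ℕ) :
    Cfg (Fin (idx e).k) (Fin (idx e).n) :=
  (idx e).M.run D (guided e z) ((idx e).M.init x) t

/-- The set in `NP^D` or `coNP^D` with number `e`. -/
def lang (e : ℕ) (D : Set Word) : Set Word :=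
  {y | y ∈ (idx e).M.language D ↔ (idx e).pol = true}

/-- The word `u` codes an input of a machine and a number of steps, and the machine accepts within
this time when guided by `z`. -/
def Accepts (u z : Word) (D : Set Word) : Prop :=
  ∃ e x r, u = padded e x r ∧ (idx e).M.Halted D (final e z D x u.length) ∧
    (final e z D x u.length).state ∈ (idx e).M.accept

/-- The greatest `t` with `(bound e).eval t + 2 * t ≤ 2 ^ k`, or `0` if there is none. Within this
time only words of length at most `2 ^ k` can be queried, and membership in the set with number `e`
of a word of length at most `t` depends on such words of the oracle only. The factor `2` leaves room
for the sparse code of the output. -/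
noncomputable def time (e k : ℕ) : ℕ :=
  Nat.findGreatest (fun t => (bound e).eval t + 2 * t ≤ 2 ^ k) (2 ^ k)

/-- All the words that the machine with number `i` outputs within the time `time e k` belong to the
set with number `e`. -/
def Sound (D : Set Word) (e i k : ℕ) : Prop :=
  (bound e).eval (time e k) + 2 * time e k ≤ 2 ^ k ∧
    ∀ x, (idx i).M.Halted D (final i [] D x (time e k)) →
      (final i [] D x (time e k)).output ∈ lang e D

/-- The word `u` is a proof that `y` belongs to the set with number `e`, with respect to the advice
`a` on which machines are sound. There are two kinds of proofs: an element of the set with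
exponential padding, and an input of a sound machine together with its padded running time. Bounding
`e` and `i` by the logarithm of the length of `u` keeps the number of relevant bits of advice
small. -/
def Proves (a : ℕ → ℕ → ℕ → Prop) (e : ℕ) (D : Set Word) (u y : Word) : Prop :=
  (∃ r, u = padded 0 y r ∧ (bound e).eval y.length < Nat.log 2 u.length ∧ y ∈ lang e D) ∨
  ∃ i x r, u = padded (i + 1) x r ∧ e ≤ Nat.log 2 u.length ∧ i ≤ Nat.log 2 u.length ∧
    a e i (Nat.log 2 u.length) ∧
    (idx i).M.Halted D (final i [] D x (time e (Nat.log 2 u.length))) ∧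
    (final i [] D x (time e (Nat.log 2 u.length))).output = y

open Classical in
/-- The word that `u` proves to belong to the set with number `e`, and the default element of the
set if `u` is not a proof. -/
noncomputable def value (a : ℕ → ℕ → ℕ → Prop) (e : ℕ) (D : Set Word) (u : Word) : Word :=
  if h : ∃ y, Proves a e D u y then h.choose else (idx e).dflt

/-- Position `j` of the sparse code of the word `y` is occupied: in this code, the letter `b` at the
place `l` of `y` occupies the position `2 * l + b`. -/
def HasBit (y : Word) (j : ℕ) : Prop := y[j / 2]? = some j.bodd

/-- The condition that defines the oracle. It consists of a generic part `G`, of the outcomes of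
guided computations, and of the values of proofs with respect to the advice `a`. -/
def Clause (G : Set Word) (a : ℕ → ℕ → ℕ → Prop) (w : Word) (D : Set Word) : Prop :=
  (∃ b, w = tagged 0 b ∧ w ∈ G) ∨
  (∃ u z, z.length = u.length ∧ w = tagged 1 (u ++ z) ∧ Accepts u z D) ∨
  ∃ e u j, j < u.length ∧ w = tagged (e + 2) (marked u j) ∧ HasBit (value a e D u) j

section Local

variable {D D' : Set Word}

theorem halted_iff_halted {K Q : Type} {M : Machine K Q} {c : Cfg K Q} :
    M.Halted D c ↔ M.Halted D' c :=
  ⟨Machine.Halted.congr, Machine.Halted.congr⟩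

theorem lang_congr {e : ℕ} {y : Word} (h : Agree ((bound e).eval y.length) D D') :
    y ∈ lang e D ↔ y ∈ lang e D' := by
  have := Machine.mem_language_congr (idx e).polyTime.choose_spec (x := y) h
  unfold lang
  simp only [Set.mem_ofPred_eq, this]

theorem final_congr {e : ℕ} {z x : Word} {t : ℕ} (h : Agree t D D') :
    final e z D x t = final e z D' x t :=
  (Machine.run_congr h).symm

theorem accepts_congr {u z : Word}
    (h : ∀ e x, final e z D x u.length = final e z D' x u.length) :
    Accepts u z D ↔ Accepts u z D' := by
  unfold Accepts
  refine exists_congr fun e => exists_congr fun x => exists_congr fun r =>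
    and_congr_right fun _ => ?_
  rw [h, halted_iff_halted (D' := D')]

theorem eval_bound_mono {e m n : ℕ} (h : m ≤ n) : (bound e).eval m ≤ (bound e).eval n := by
  rw [Polynomial.eval_eq_sum_range, Polynomial.eval_eq_sum_range]
  gcongr

theorem time_le (e k : ℕ) : time e k ≤ 2 ^ k := Nat.findGreatest_le _

theorem output_length_final_le (e : ℕ) (z : Word) (D : Set Word) (x : Word) (t : ℕ) :
    (final e z D x t).output.length ≤ t := by
  obtain ⟨s, hs, h, -⟩ := Machine.exists_steps_run (M := (idx e).M) (D := D) (guided e z)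
    ((idx e).M.init x) t
  have := h.output_length_le
  simp only [Machine.init, List.length_nil, zero_add] at this
  exact this.trans hs

theorem sound_congr {e i k : ℕ} (h : Agree (2 ^ k) D D') : Sound D e i k ↔ Sound D' e i k := by
  unfold Sound
  refine and_congr_right fun hk => forall_congr' fun x => ?_
  rw [final_congr (h.mono (time_le e k)), halted_iff_halted (D' := D')]
  refine imp_congr_right fun _ => lang_congr (h.mono ?_)
  have := eval_bound_mono (e := e) (output_length_final_le i [] D' x (time e k))
  omega

theorem proves_congr {a a' : ℕ → ℕ → ℕ → Prop} {e : ℕ} {u : Word}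
    (ha : ∀ i, e ≤ Nat.log 2 u.length → i ≤ Nat.log 2 u.length →
      (a e i (Nat.log 2 u.length) ↔ a' e i (Nat.log 2 u.length)))
    (hl : Agree (Nat.log 2 u.length) D D')
    (hf : ∀ i x r, u = padded (i + 1) x r →
      final i [] D x (time e (Nat.log 2 u.length)) =
        final i [] D' x (time e (Nat.log 2 u.length))) :
    Proves a e D u = Proves a' e D' u := by
  funext y
  unfold Proves
  refine propext (or_congr ?_ ?_)
  · refine exists_congr fun r => and_congr_right fun _ => and_congr_right fun h => ?_
    exact lang_congr (hl.mono h.le)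
  · refine exists_congr fun i => exists_congr fun x => exists_congr fun r =>
      and_congr_right fun h => and_congr_right fun h₁ => and_congr_right fun h₂ => ?_
    rw [ha i h₁ h₂, hf i x r h, halted_iff_halted (D' := D')]

theorem log_lt_length {u : Word} (hu : u ≠ []) : Nat.log 2 u.length < u.length :=
  Nat.log_lt_self 2 (List.length_eq_zero_iff.not.2 hu)

theorem time_log_le {u : Word} (hu : u ≠ []) (e : ℕ) : time e (Nat.log 2 u.length) ≤ u.length :=
  (time_le _ _).trans (Nat.pow_log_le_self 2 (List.length_eq_zero_iff.not.2 hu))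

theorem proves_congr_of_agree {a a' : ℕ → ℕ → ℕ → Prop} {e : ℕ} {u : Word} (hu : u ≠ [])
    (ha : ∀ i, e ≤ Nat.log 2 u.length → i ≤ Nat.log 2 u.length →
      (a e i (Nat.log 2 u.length) ↔ a' e i (Nat.log 2 u.length)))
    (h : Agree u.length D D') : Proves a e D u = Proves a' e D' u :=
  proves_congr ha (h.mono (log_lt_length hu).le) fun _ _ _ _ =>
    final_congr (h.mono (time_log_le hu e))

theorem value_eq_of_proves_eq {a a' : ℕ → ℕ → ℕ → Prop} {e : ℕ} {u : Word}
    (h : Proves a e D u = Proves a' e D' u) : value a e D u = value a' e D' u := by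
  classical
  exact congrArg (fun P : Word → Prop => if h : ∃ y, P y then h.choose else (idx e).dflt) h

theorem clause_congr {G G' : Set Word} {a a' : ℕ → ℕ → ℕ → Prop} {w : Word}
    (hG : w ∈ G ↔ w ∈ G')
    (hD : ∀ v : Word, v.length < w.length → (v ∈ D ↔ v ∈ D'))
    (ha : ∀ e i k, e ≤ k → i ≤ k → 2 ^ k < w.length → (a e i k ↔ a' e i k)) :
    Clause G a w D ↔ Clause G' a' w D' := by
  unfold Clause
  refine or_congr ?_ (or_congr ?_ ?_)
  · rw [hG]
  · refine exists_congr fun u => exists_congr fun z => and_congr_right fun h =>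
      and_congr_right fun h' => accepts_congr fun e x => final_congr fun v hv => hD v ?_
    rw [h']
    simp
    omega
  · refine exists_congr fun e => exists_congr fun u => exists_congr fun j =>
      and_congr_right fun h => and_congr_right fun h' => ?_
    have hu : u ≠ [] := by
      rintro rfl
      simp at h
    have hw : u.length < w.length := by
      rw [h']
      simp
      omega
    rw [value_eq_of_proves_eq (proves_congr_of_agree hu (fun i he hi => ha _ _ _ he hi ?_)
      fun v hv => hD v (by omega))]
    exact (Nat.pow_log_le_self 2 (List.length_eq_zero_iff.not.2 hu)).trans_lt hw

end Local

/-- The oracle `O` satisfies its defining condition for the generic part `G` and the advice `a`. -/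
def IsOracle (G : Set Word) (a : ℕ → ℕ → ℕ → Prop) (O : Set Word) : Prop :=
  ∀ w, w ∈ O ↔ Clause G a w O

theorem exists_isOracle (G : Set Word) (a : ℕ → ℕ → ℕ → Prop) : ∃ O, IsOracle G a O :=
  exists_fixpoint (Clause G a) fun _ _ _ h => clause_congr Iff.rfl h fun _ _ _ _ _ _ => Iff.rfl

/-- There is an oracle whose advice is truthful. -/
theorem exists_isOracle_sound (G : Set Word) : ∃ O, IsOracle G (Sound O) O :=
  exists_fixpoint (fun w D => Clause G (Sound D) w D) fun _ _ _ h =>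
    clause_congr Iff.rfl h fun _ _ _ _ _ hk => sound_congr fun v hv => h v (by omega)

namespace IsOracle

variable {G G' : Set Word} {a a' : ℕ → ℕ → ℕ → Prop} {O O' : Set Word}

/-- The words of length at most `m` of an oracle are determined by the words of length at most `m` of
its generic part and by the advice on exponents below the logarithm of `m`. -/
theorem agree (hO : IsOracle G a O) (hO' : IsOracle G' a' O') {m : ℕ} (hG : Agree m G G')
    (ha : ∀ e i k, e ≤ k → i ≤ k → 2 ^ k < m → (a e i k ↔ a' e i k)) : Agree m O O' := by
  intro w
  induction h : w.length using Nat.strong_induction_on generalizing w with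
  | _ l ih =>
    subst h
    intro hw
    rw [hO, hO']
    exact clause_congr (hG w hw) (fun v hv => ih _ hv v rfl (by omega))
      fun e i k he hi hk => ha e i k he hi (by omega)

theorem tagged_zero_mem (hO : IsOracle G a O) (b : Word) :
    tagged 0 b ∈ O ↔ tagged 0 b ∈ G := by
  rw [hO]
  unfold Clause
  simp [tagged_inj]

theorem tagged_one_mem (hO : IsOracle G a O) {u z : Word} (h : z.length = u.length) :
    tagged 1 (u ++ z) ∈ O ↔ Accepts u z O := by
  rw [hO]
  unfold Clause
  constructor
  · rintro (⟨b, hb, -⟩ | ⟨u', z', h', hw, hA⟩ | ⟨e, u', j, -, hw, -⟩)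
    · simp [tagged_inj] at hb
    · obtain ⟨-, hw⟩ := tagged_inj.1 hw
      have hl := congrArg List.length hw
      simp only [List.length_append] at hl
      obtain ⟨rfl, rfl⟩ := List.append_inj hw (by omega)
      exact hA
    · simp [tagged_inj] at hw
  · exact fun hA => Or.inr (Or.inl ⟨u, z, h, rfl, hA⟩)

theorem tagged_add_two_mem (hO : IsOracle G a O) {e j : ℕ} {u : Word} (h : j < u.length) :
    tagged (e + 2) (marked u j) ∈ O ↔ HasBit (value a e O u) j := by
  rw [hO]
  unfold Clause
  constructor
  · rintro (⟨b, hb, -⟩ | ⟨u', z', h', hw, -⟩ | ⟨e', u', j', h', hw, hA⟩)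
    · simp [tagged_inj] at hb
    · simp [tagged_inj] at hw
    · rw [tagged_inj, marked_inj h.le h'.le] at hw
      obtain ⟨he, rfl, rfl⟩ := hw
      obtain rfl : e = e' := by omega
      exact hA
  · exact fun hA => Or.inr (Or.inr ⟨e, u, j, h, rfl, hA⟩)

end IsOracle

/-! ### Dependence on the generic part -/

/-- With the advice fixed, membership of `w` in the oracle depends only on the words in `S` and on
the words of length at most `l` of the generic part. -/
def DependsOn (G : Set Word) (a : ℕ → ℕ → ℕ → Prop) (O : Set Word) (l : ℕ) (S : List Word)
    (w : Word) : Prop :=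
  ∀ G' O', IsOracle G' a O' → Agree l G G' → (∀ v ∈ S, v ∈ G ↔ v ∈ G') → (w ∈ O ↔ w ∈ O')

theorem exists_dependsOn_list {G : Set Word} {a : ℕ → ℕ → ℕ → Prop} {O : Set Word} {l : ℕ}
    (ql : List Word) (h : ∀ q ∈ ql, ∃ S : List Word, S.length ≤ q.length ∧ DependsOn G a O l S q) :
    ∃ S : List Word, S.length ≤ (ql.map List.length).sum ∧
      ∀ q ∈ ql, DependsOn G a O l S q := by
  induction ql with
  | nil => exact ⟨[], by simp, by simp⟩
  | cons q ql ih =>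
    obtain ⟨S, hS, hS'⟩ := ih fun q hq => h q (List.mem_cons_of_mem _ hq)
    obtain ⟨T, hT, hT'⟩ := h q List.mem_cons_self
    refine ⟨T ++ S, by simp; omega, fun p hp G' O' hO' hG hv => ?_⟩
    rcases List.mem_cons.1 hp with rfl | hp
    · exact hT' G' O' hO' hG fun v hv' => hv v (List.mem_append_left _ hv')
    · exact hS' p hp G' O' hO' hG fun v hv' => hv v (List.mem_append_right _ hv')

/-- A run of `t` steps depends on at most `t` words of the generic part. -/
theorem exists_dependsOn_run {G : Set Word} {a : ℕ → ℕ → ℕ → Prop} {O : Set Word} {l m : ℕ}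
    (h : ∀ q : Word, q.length ≤ m →
      ∃ S : List Word, S.length ≤ q.length ∧ DependsOn G a O l S q)
    {K Q : Type} (M : Machine K Q) (ch : ℕ → Action K Q) (x : Word) {t : ℕ} (ht : t ≤ m) :
    ∃ S : List Word, S.length ≤ t ∧ ∀ G' O', IsOracle G' a O' → Agree l G G' →
      (∀ v ∈ S, v ∈ G ↔ v ∈ G') → M.run O' ch (M.init x) t = M.run O ch (M.init x) t := by
  obtain ⟨ql, hlen, hql⟩ := M.exists_queries O ch (M.init x) t
  have hsum : (ql.map List.length).sum ≤ t := by
    simp only [Machine.init, List.length_nil, zero_add] at hlen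
    exact (Nat.le_add_right _ _).trans hlen
  have hle : ∀ q ∈ ql, q.length ≤ m := fun q hq =>
    ((List.single_le_sum (by simp) _ (List.mem_map_of_mem (f := List.length) hq)).trans hsum).trans
      ht
  obtain ⟨S, hS, hS'⟩ := exists_dependsOn_list ql fun q hq => h q (hle q hq)
  exact ⟨S, hS.trans hsum, fun G' O' hO' hG hv => hql O' fun q hq => hS' q hq G' O' hO' hG hv⟩

/-- A word of the oracle depends on no more words of the generic part than it has letters, apart from
short words: a recorded computation asks queries of smaller total length, so the bound is inherited
by induction. -/
theorem IsOracle.exists_dependsOn {G : Set Word} {a : ℕ → ℕ → ℕ → Prop} {O : Set Word}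
    (hO : IsOracle G a O) {l : ℕ} (w : Word) (hw : w.length ≤ 2 ^ l) :
    ∃ S : List Word, S.length ≤ w.length ∧ DependsOn G a O l S w := by
  induction h : w.length using Nat.strong_induction_on generalizing w with
  | _ m ih =>
    subst h
    by_cases h₀ : ∃ b, w = tagged 0 b
    · obtain ⟨b, rfl⟩ := h₀
      refine ⟨[tagged 0 b], by simp, fun G' O' hO' _ hv => ?_⟩
      rw [hO.tagged_zero_mem, hO'.tagged_zero_mem]
      exact hv _ (by simp)
    by_cases h₁ : ∃ u z, z.length = u.length ∧ w = tagged 1 (u ++ z)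
    · obtain ⟨u, z, h, rfl⟩ := h₁
      by_cases hu : ∃ e x r, u = padded e x r
      · obtain ⟨e, x, r, hu⟩ := hu
        have hlen : u.length < (tagged 1 (u ++ z)).length := by
          simp
          omega
        obtain ⟨S, hS, hS'⟩ := exists_dependsOn_run (m := u.length)
          (fun q hq => ih q.length (by omega) q (by omega) rfl) (idx e).M (guided e z) x le_rfl
        refine ⟨S, by omega, fun G' O' hO' hG hv => ?_⟩
        rw [hO.tagged_one_mem h, hO'.tagged_one_mem h]
        have hf : final e z O x u.length = final e z O' x u.length :=
          (hS' G' O' hO' hG hv).symm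
        unfold Accepts
        refine exists_congr fun e' => exists_congr fun x' => exists_congr fun r' =>
          and_congr_right fun h' => ?_
        obtain ⟨rfl, rfl, rfl⟩ := padded_inj.1 (hu.symm.trans h')
        rw [hf, halted_iff_halted (D' := O')]
      · refine ⟨[], by simp, fun G' O' hO' _ _ => ?_⟩
        rw [hO.tagged_one_mem h, hO'.tagged_one_mem h]
        refine iff_of_false ?_ ?_ <;>
        · rintro ⟨e, x, r, hu', -⟩
          exact hu ⟨e, x, r, hu'⟩
    by_cases h₂ : ∃ e u j, j < u.length ∧ w = tagged (e + 2) (marked u j)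
    · obtain ⟨e, u, j, h, rfl⟩ := h₂
      have hu : u ≠ [] := by
        rintro rfl
        simp at h
      have hlen : u.length < (tagged (e + 2) (marked u j)).length := by
        simp
        omega
      -- the words that a proof with exponential padding refers to are of logarithmic length
      have hlog : Nat.log 2 u.length ≤ l := by
        rw [← Nat.lt_succ_iff, Nat.succ_eq_add_one]
        apply Nat.log_lt_of_lt_pow (List.length_eq_zero_iff.not.2 hu)
        rw [pow_succ]
        omega
      have hshort : ∀ G' O', IsOracle G' a O' → Agree l G G' →
          Agree (Nat.log 2 u.length) O O' := fun G' O' hO' hG =>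
        (hO.agree hO' hG fun _ _ _ _ _ _ => Iff.rfl).mono hlog
      by_cases hp : ∃ i x r, u = padded (i + 1) x r
      · obtain ⟨i, x, r, hp⟩ := hp
        obtain ⟨S, hS, hS'⟩ := exists_dependsOn_run (m := u.length)
          (fun q hq => ih q.length (by omega) q (by omega) rfl) (idx i).M (guided i []) x
          (time_log_le hu e)
        refine ⟨S, by have := time_log_le hu e; omega, fun G' O' hO' hG hv => ?_⟩
        rw [hO.tagged_add_two_mem h, hO'.tagged_add_two_mem h]
        rw [value_eq_of_proves_eq (proves_congr (fun _ _ _ => Iff.rfl)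
          (hshort G' O' hO' hG) ?_)]
        intro i' x' r' h'
        obtain ⟨hi, rfl, rfl⟩ := padded_inj.1 (hp.symm.trans h')
        obtain rfl : i = i' := by omega
        exact (hS' G' O' hO' hG hv).symm
      · refine ⟨[], by simp, fun G' O' hO' hG _ => ?_⟩
        rw [hO.tagged_add_two_mem h, hO'.tagged_add_two_mem h]
        rw [value_eq_of_proves_eq (proves_congr (fun _ _ _ => Iff.rfl)
          (hshort G' O' hO' hG) fun i' x' r' h' => (hp ⟨i', x', r', h'⟩).elim)]
    · refine ⟨[], by simp, fun G' O' hO' _ _ => ?_⟩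
      rw [hO, hO']
      have : ∀ G D, ¬ Clause G a w D := by
        rintro G D (⟨b, hb, -⟩ | ⟨u, z, h, hw, -⟩ | ⟨e, u, j, h, hw, -⟩)
        · exact h₀ ⟨b, hb⟩
        · exact h₁ ⟨u, z, h, hw⟩
        · exact h₂ ⟨e, u, j, h, hw⟩
      exact iff_of_false (this _ _) (this _ _)

/-! ### Complete sets -/

theorem exists_eval_le_pow (p : Polynomial ℕ) : ∃ d, ∀ n, p.eval n ≤ (n + 2) ^ d := by
  induction p using Polynomial.induction_on' with
  | add p q hp hq =>
    obtain ⟨a, ha⟩ := hp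
    obtain ⟨b, hb⟩ := hq
    refine ⟨a + b + 1, fun n => ?_⟩
    have h₁ : (n + 2) ^ a ≤ (n + 2) ^ (a + b) := Nat.pow_le_pow_right (by omega) (by omega)
    have h₂ : (n + 2) ^ b ≤ (n + 2) ^ (a + b) := Nat.pow_le_pow_right (by omega) (by omega)
    have h₃ : (n + 2) ^ (a + b) * 2 ≤ (n + 2) ^ (a + b) * (n + 2) :=
      Nat.mul_le_mul_left _ (by omega)
    rw [Polynomial.eval_add, pow_succ]
    linarith [ha n, hb n]
  | monomial k c =>
    refine ⟨c + k, fun n => ?_⟩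
    rw [Polynomial.eval_monomial, pow_add]
    refine Nat.mul_le_mul ?_ (Nat.pow_le_pow_left (by omega) k)
    exact (Nat.lt_two_pow_self (n := c)).le.trans (Nat.pow_le_pow_left (by omega) c)

theorem exists_idx {k n : ℕ} (M : Machine (Fin k) (Fin n)) (hM : M.PolyTime) (pol : Bool)
    (dflt : Word) : ∃ e, idx e = ⟨k, n, M, hM, pol, dflt⟩ :=
  idx_surjective _

theorem manyOneComplete_guessSet {G : Set Word} {a : ℕ → ℕ → ℕ → Prop} {O : Set Word}
    (hO : IsOracle G a O) : ManyOneComplete O (classNP O) (guessSet 1 O) := by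
  refine ⟨guessSet_mem_classNP 1 O, ?_⟩
  rintro B ⟨k, n, M, hM, hB⟩
  obtain ⟨e, he⟩ := exists_idx M hM true []
  have hB' : (idx e).M.language O = B := by
    rw [he]
    exact hB
  obtain ⟨d, hd⟩ := exists_eval_le_pow ((.C (width e) + 1) * bound e)
  refine ⟨padFn e d, padFn_mem_classFP e d O, fun x => ?_⟩
  have hlen : (width e + 1) * (bound e).eval x.length ≤ (padFn e d x).length := by
    have := hd x.length
    simp only [Polynomial.eval_mul, Polynomial.eval_add, Polynomial.eval_C,
      Polynomial.eval_one] at this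
    rw [padFn, length_padded]
    omega
  have hmem : padFn e d x ∈ guessSet 1 O ↔
      ∃ z : Word, z.length = (padFn e d x).length ∧ Accepts (padFn e d x) z O :=
    exists_congr fun z => and_congr_right fun hz => hO.tagged_one_mem hz
  rw [hmem, ← hB']
  constructor
  · rintro ⟨T, c, hT, hc, hacc⟩
    have hTb := le_bound hT
    obtain ⟨acts, hacts⟩ := hT.exists_run
    obtain ⟨z, hz, hz'⟩ := exists_guided e acts T
    have hmul := Nat.mul_le_mul_left (width e) hTb
    rw [add_one_mul] at hlen
    have hfin : final e (z ++ List.replicate ((padFn e d x).length - z.length) true) O x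
        (padFn e d x).length = c := by
      have hr := hacts _ (hz' (List.replicate ((padFn e d x).length - z.length) true))
      rw [final, Machine.run_of_halted (s := T) (by omega) (hr ▸ hc), hr]
    refine ⟨z ++ List.replicate ((padFn e d x).length - z.length) true, ?_, e, x, _, rfl, ?_, ?_⟩
    · simp
      omega
    · exact hfin.symm ▸ hc
    · exact hfin.symm ▸ hacc
  · rintro ⟨z, -, e', x', r, h, hhalt, hacc⟩
    obtain ⟨rfl, rfl, -⟩ := padded_inj.1 h
    obtain ⟨s, -, hs, -⟩ := Machine.exists_steps_run (M := (idx e).M) (D := O) (guided e z)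
      ((idx e).M.init x) (padFn e d x).length
    exact ⟨s, _, hs, hhalt, hacc⟩

theorem ManyOneComplete.compl {O A : Set Word} (h : ManyOneComplete O (classNP O) A) :
    ManyOneComplete O (classCoNP O) Aᶜ := by
  refine ⟨by simpa [classCoNP] using h.1, fun B hB => ?_⟩
  obtain ⟨r, hr, hr'⟩ := h.2 Bᶜ hB
  refine ⟨r, hr, fun x => ?_⟩
  have := hr' x
  simp only [Set.mem_compl_iff] at this ⊢
  tauto

/-! ### Optimal proof systems -/

theorem hasBit_cons (b : Bool) (y : Word) (j : ℕ) : HasBit (b :: y) (j + 2) ↔ HasBit y j := by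
  simp [HasBit]

open Classical in
/-- A word is recovered from its sparse code by listing the parities of the occupied positions. -/
theorem flatMap_hasBit (y : Word) {n : ℕ} (h : 2 * y.length ≤ n) :
    ((List.range n).flatMap fun j => if HasBit y j then [j.bodd] else []) = y := by
  induction y generalizing n with
  | nil => simp [HasBit]
  | cons b y ih =>
    rw [List.length_cons] at h
    obtain ⟨n, rfl⟩ := Nat.exists_eq_add_of_le' (show 2 ≤ n by omega)
    have h₀ : HasBit (b :: y) 0 ↔ b = false := by simp [HasBit]
    have h₁ : HasBit (b :: y) 1 ↔ b = true := by simp [HasBit]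
    rw [List.range_succ_eq_map, List.range_succ_eq_map]
    simp only [List.flatMap_cons, List.map_cons, List.map_map, List.flatMap_map,
      Function.comp_apply, Nat.succ_eq_add_one, zero_add, h₀, h₁, add_assoc, Nat.reduceAdd,
      hasBit_cons]
    have hb : ∀ j : ℕ, (j + 2).bodd = j.bodd := fun j => by simp
    simp only [hb, ih (show 2 * y.length ≤ n by omega)]
    cases b <;> simp

theorem Proves.unique {a : ℕ → ℕ → ℕ → Prop} {e : ℕ} {D : Set Word} {u y y' : Word}
    (h : Proves a e D u y) (h' : Proves a e D u y') : y = y' := by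
  rcases h with ⟨r, hu, -⟩ | ⟨i, x, r, hu, -, -, -, -, hy⟩ <;>
    rcases h' with ⟨r', hu', -⟩ | ⟨i', x', r', hu', -, -, -, -, hy'⟩
  · exact (padded_inj.1 (hu.symm.trans hu')).2.1
  · have := (padded_inj.1 (hu.symm.trans hu')).1
    omega
  · have := (padded_inj.1 (hu.symm.trans hu')).1
    omega
  · obtain ⟨h, rfl, -⟩ := padded_inj.1 (hu.symm.trans hu')
    obtain rfl : i = i' := by omega
    rw [← hy, ← hy']

theorem Proves.value_eq {a : ℕ → ℕ → ℕ → Prop} {e : ℕ} {D : Set Word} {u y : Word}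
    (h : Proves a e D u y) : value a e D u = y := by
  have hex : ∃ y, Proves a e D u y := ⟨y, h⟩
  rw [value, dif_pos hex]
  exact hex.choose_spec.unique h

theorem Proves.mem_lang {e : ℕ} {D : Set Word} {u y : Word} (h : Proves (Sound D) e D u y) :
    y ∈ lang e D := by
  rcases h with ⟨r, -, -, h⟩ | ⟨i, x, r, -, -, -, hs, hh, rfl⟩
  · exact h
  · exact hs.2 x hh

theorem Proves.length_le {e : ℕ} {D : Set Word} {u y : Word} (h : Proves (Sound D) e D u y) :
    2 * y.length ≤ u.length := by
  rcases h with ⟨r, rfl, -⟩ | ⟨i, x, r, hu, -, -, hs, -, rfl⟩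
  · simp
    omega
  · have h₁ := output_length_final_le i [] D x (time e (Nat.log 2 u.length))
    have h₂ := hs.1
    have h₃ := Nat.pow_log_le_self 2 (x := u.length) (by rw [hu]; simp)
    omega

theorem IsOracle.readOut_eq {G : Set Word} {a : ℕ → ℕ → ℕ → Prop} {O : Set Word}
    (hO : IsOracle G a O) {e : ℕ} {u : Word} (h : 2 * (value a e O u).length ≤ u.length) :
    readOut (e + 2) O u = value a e O u := by
  classical
  refine Eq.trans ?_ (flatMap_hasBit _ h)
  unfold readOut
  rw [List.flatMap_congr]
  intro j hj
  rw [List.mem_range] at hj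
  simp only [hO.tagged_add_two_mem hj]

theorem IsOracle.readFn_eq_of_proves {G : Set Word} {O : Set Word} (hO : IsOracle G (Sound O) O)
    {e c : ℕ} {v y : Word} (h : Proves (Sound O) e O (v ++ List.replicate c true) y) :
    readFn (e + 2) c O v = y := by
  rw [readFn, hO.readOut_eq, h.value_eq]
  rw [h.value_eq]
  exact h.length_le

theorem padded_append (i : ℕ) (x : Word) (r c : ℕ) :
    padded i x r ++ List.replicate c true = padded i x (r + c) := by
  simp [padded, tagged]

/-- The default element keeps the range of the proof system within the set, and the proofs with
exponential padding exhaust the set. -/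
theorem IsOracle.range_readFn {G : Set Word} {O : Set Word} (hO : IsOracle G (Sound O) O)
    {e c : ℕ} (hc : 2 * (idx e).dflt.length ≤ c) (he : (idx e).dflt ∈ lang e O) :
    Set.range (readFn (e + 2) c O) = lang e O := by
  refine Set.Subset.antisymm ?_ fun y hy => ?_
  · rintro _ ⟨v, rfl⟩
    by_cases h : ∃ y, Proves (Sound O) e O (v ++ List.replicate c true) y
    · obtain ⟨y, h⟩ := h
      rw [hO.readFn_eq_of_proves h]
      exact h.mem_lang
    · have hv : value (Sound O) e O (v ++ List.replicate c true) = (idx e).dflt := dif_neg h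
      rw [readFn, hO.readOut_eq, hv]
      · exact he
      · rw [hv]
        simp
        omega
  · refine ⟨padded 0 y (2 ^ ((bound e).eval y.length + 1)), hO.readFn_eq_of_proves ?_⟩
    rw [padded_append]
    refine Or.inl ⟨_, rfl, ?_, hy⟩
    refine Nat.lt_of_succ_le (Nat.le_log_of_pow_le (by norm_num) ?_)
    simp
    omega

/-- Every proof system `f` for the set is simulated by padding: with enough padding, the running time
of `f` is within the relevant time bound, and a machine that computes `f` is sound since the range of
`f` is the set. -/
theorem IsOracle.pSimulated_readFn {G : Set Word} {O : Set Word} (hO : IsOracle G (Sound O) O)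
    {e : ℕ} (c : ℕ) {f : Word → Word} (hf : f ∈ classFP O) (hr : Set.range f = lang e O) :
    PSimulated O f (readFn (e + 2) c O) := by
  obtain ⟨k, n, M, hdet, hM, hcomp⟩ := hf
  obtain ⟨i, hi⟩ := exists_idx M hM true []
  replace hdet : (idx i).M.Deterministic := by
    rw [hi]
    exact hdet
  replace hcomp : (idx i).M.Computes O f := by
    rw [hi]
    exact hcomp
  obtain ⟨d, hd⟩ := exists_eval_le_pow ((bound e).comp (bound i) + 2 * bound i)
  refine ⟨padFn (i + 1) (d + e + i + 1), padFn_mem_classFP _ _ O,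
    .C (i + 1) + 2 * .X + (.X + 2) ^ (d + e + i + 1) + 2, fun x => ⟨?_, ?_⟩⟩
  · rw [padFn, length_padded]
    simp
  refine hO.readFn_eq_of_proves ?_
  rw [padFn, padded_append]
  set u := padded (i + 1) x ((x.length + 2) ^ (d + e + i + 1) - 1 + c) with hu
  have hu₀ : u.length ≠ 0 := by
    rw [hu, length_padded]
    omega
  -- the padding makes the relevant time bound exceed the running time of `f` on `x`
  have hpow : (x.length + 2) ^ d * 2 ^ (e + i) ≤ 2 ^ Nat.log 2 u.length := by
    have h₁ : (x.length + 2) ^ (d + e + i + 1) ≤ u.length := by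
      rw [hu, length_padded]
      omega
    have h₂ := h₁.trans (Nat.lt_pow_succ_log_self one_lt_two u.length).le
    have h₃ : 2 ^ (e + i + 1) ≤ (x.length + 2) ^ (e + i + 1) :=
      Nat.pow_le_pow_left (by omega) _
    have h₄ : (x.length + 2) ^ (d + e + i + 1) =
        (x.length + 2) ^ d * (x.length + 2) ^ (e + i + 1) := by
      rw [← pow_add]
      congr 1
      ring
    have h₅ := Nat.mul_le_mul_left ((x.length + 2) ^ d) h₃
    rw [h₄] at h₂
    have h₆ := h₅.trans h₂
    rw [pow_succ, Nat.succ_eq_add_one, pow_succ, ← mul_assoc] at h₆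
    exact Nat.le_of_mul_le_mul_right h₆ (by norm_num)
  set k := Nat.log 2 u.length with hk
  have hei : e + i ≤ k := by
    refine (Nat.pow_le_pow_iff_right one_lt_two).1 (le_trans ?_ hpow)
    exact Nat.le_mul_of_pos_left _ (by positivity)
  have hdk : (x.length + 2) ^ d ≤ 2 ^ k :=
    le_trans (Nat.le_mul_of_pos_right _ (by positivity)) hpow
  have hfit : (bound e).eval ((bound i).eval x.length) + 2 * (bound i).eval x.length ≤ 2 ^ k := by
    refine le_trans ?_ hdk
    simpa using hd x.length
  have hle : (bound i).eval x.length ≤ 2 ^ k := by omega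
  have htime : (bound i).eval x.length ≤ time e k := Nat.le_findGreatest hle hfit
  have hspec : (bound e).eval (time e k) + 2 * time e k ≤ 2 ^ k :=
    Nat.findGreatest_spec (P := fun t => (bound e).eval t + 2 * t ≤ 2 ^ k) hle hfit
  obtain ⟨T, b, hT, hb, hout⟩ := hcomp x
  have hTk : T ≤ time e k := (le_bound hT).trans htime
  have hrun := hdet.run_eq (guided i []) hT
  have hfin : final i [] O x (time e k) = b := by
    rw [final, Machine.run_of_halted hTk (hrun ▸ hb), hrun]
  refine Or.inr ⟨i, x, _, hu, ?_, ?_, ⟨hspec, fun x' hx' => ?_⟩, ?_, ?_⟩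
  · omega
  · omega
  · obtain ⟨T', b', hT', hb', hout'⟩ := hcomp x'
    obtain ⟨s, -, hs, -⟩ := Machine.exists_steps_run (M := (idx i).M) (D := O) (guided i [])
      ((idx i).M.init x') (time e k)
    have := hdet.halted_unique hs hx' hT' hb'
    rw [final, this, hout', ← hr]
    exact ⟨x', rfl⟩
  · rw [← hk, hfin]
    exact hb
  · rw [← hk, hfin]
    exact hout

theorem IsOracle.hasPOptimal_lang {G : Set Word} {O : Set Word} (hO : IsOracle G (Sound O) O)
    {e : ℕ} (he : (idx e).dflt ∈ lang e O) : HasPOptimal O (lang e O) := by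
  have hr := hO.range_readFn le_rfl he
  exact ⟨readFn (e + 2) _ O, ⟨readFn_mem_classFP _ _ O, fun f hf hfr =>
    hO.pSimulated_readFn _ hf (hfr.trans hr)⟩, hr⟩

theorem IsOracle.hasPOptimal {G : Set Word} {O : Set Word} (hO : IsOracle G (Sound O) O)
    {A : Set Word} (hA : A ∈ classNP O ∪ classCoNP O) (hne : A.Nonempty) : HasPOptimal O A := by
  obtain ⟨y, hy⟩ := hne
  have key : ∀ B ∈ classNP O, ∀ pol : Bool, (∀ x, x ∈ A ↔ (x ∈ B ↔ pol = true)) →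
      HasPOptimal O A := by
    rintro B ⟨k, n, M, hM, hB⟩ pol h
    obtain ⟨e, he⟩ := exists_idx M hM pol y
    have hl : lang e O = A := by
      ext x
      rw [h, ← hB]
      unfold lang
      rw [he]
      rfl
    have hy' : (idx e).dflt ∈ lang e O := by
      rw [hl, he]
      exact hy
    exact hl ▸ hO.hasPOptimal_lang hy'
  rcases hA with hA | hA
  · exact key A hA true (by simp)
  · exact key Aᶜ hA false (by simp)

/-! ### Diagonalization -/

/-- A set can be found that meets countably many requirements, if every finite approximation can be
extended to one that forces a given requirement. -/
theorem exists_generic (P : ℕ → ℕ → Set Word → Prop)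
    (h : ∀ i l G₀, ∃ m G₁, l ≤ m ∧ Agree l G₀ G₁ ∧ P i m G₁) :
    ∃ G, ∀ i, ∃ m G₁, Agree m G G₁ ∧ P i m G₁ := by
  choose m G hm hG hP using h
  let A : ℕ → ℕ × Set Word := fun i =>
    Nat.rec (m 0 0 ∅, G 0 0 ∅) (fun i B => (m (i + 1) (B.1 + 1) B.2, G (i + 1) (B.1 + 1) B.2)) i
  have hAP : ∀ i, P i (A i).1 (A i).2 := by
    rintro (_ | i)
    · exact hP _ _ _
    · exact hP _ _ _
  have hA₁ : ∀ i, (A i).1 + 1 ≤ (A (i + 1)).1 := fun i => hm _ _ _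
  have hA₂ : ∀ i, Agree ((A i).1 + 1) (A i).2 (A (i + 1)).2 := fun i => hG _ _ _
  have hle : ∀ i, i ≤ (A i).1 := by
    intro i
    induction i with
    | zero => exact Nat.zero_le _
    | succ i ih => have := hA₁ i; omega
  have hmono : ∀ i j, i ≤ j → (A i).1 ≤ (A j).1 ∧ Agree (A i).1 (A i).2 (A j).2 := by
    intro i j hij
    induction j, hij using Nat.le_induction with
    | base => exact ⟨le_rfl, fun _ _ => Iff.rfl⟩
    | succ j _ ih =>
      have := hA₁ j
      exact ⟨by omega, fun w hw => (ih.2 w hw).trans (hA₂ j w (by omega))⟩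
  refine ⟨{w | w ∈ (A w.length).2}, fun i => ⟨(A i).1, (A i).2, fun w hw => ?_, hAP i⟩⟩
  rcases le_total w.length i with h | h
  · exact (hmono _ _ h).2 w (hle _)
  · exact ((hmono _ _ h).2 w hw).symm

theorem exists_pow_le_two_pow (d l : ℕ) : ∃ s, l ≤ s ∧ (s + 2) ^ d ≤ 2 ^ s := by
  have h := tendsto_pow_const_div_const_pow_of_one_lt d (one_lt_two (α := ℝ))
  have h' := (h.eventually (gt_mem_nhds (show (0 : ℝ) < 1 / 4 by norm_num))).and
    (Filter.eventually_ge_atTop (l + 2))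
  obtain ⟨t, ht, hl⟩ := h'.exists
  obtain ⟨s, rfl⟩ := Nat.exists_eq_add_of_le' (show 2 ≤ t by omega)
  refine ⟨s, by omega, ?_⟩
  rw [div_lt_iff₀ (by positivity), pow_add] at ht
  have : ((s + 2 : ℕ) : ℝ) ^ d < 2 ^ s := by linarith
  exact_mod_cast this.le

/-- The parameters of a diagonalization step: `n` is the length of the inputs, and the number of
relevant bits of advice is `κ ^ 3`. -/
theorem exists_params (p : Polynomial ℕ) (l : ℕ) :
    ∃ n κ, l ≤ n ∧ p.eval n < 2 ^ κ ∧ κ ^ 3 + κ ≤ n := by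
  obtain ⟨d, hd⟩ := exists_eval_le_pow p
  let κ : Polynomial ℕ := (.X + 1) * .C d + 1
  obtain ⟨d', hd'⟩ := exists_eval_le_pow (κ ^ 3 + κ)
  obtain ⟨s, hs, hs'⟩ := exists_pow_le_two_pow d' (l + 1)
  refine ⟨2 ^ s, κ.eval s, ?_, ?_, ?_⟩
  · have := Nat.lt_two_pow_self (n := s)
    omega
  · refine (hd _).trans_lt ?_
    have h₁ : 2 ^ s + 2 ≤ 2 ^ (s + 1) := by
      have : 2 ^ 1 ≤ 2 ^ s := Nat.pow_le_pow_right (by norm_num) (by omega)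
      rw [pow_succ]
      omega
    refine (Nat.pow_le_pow_left h₁ d).trans_lt ?_
    rw [← pow_mul]
    refine Nat.pow_lt_pow_right one_lt_two ?_
    simp [κ]
  · have := (hd' s).trans hs'
    simpa using this

theorem Machine.Deterministic.mem_language_iff_run {K Q : Type} {M : Machine K Q}
    (hM : M.Deterministic) {p : Polynomial ℕ}
    (hp : ∀ (D : Set Word) (x : Word) (t : ℕ) (c : Cfg K Q),
      M.Steps D t (M.init x) c → t ≤ p.eval x.length)
    (ch : ℕ → Action K Q) (D : Set Word) (x : Word) :
    x ∈ M.language D ↔ M.Halted D (M.run D ch (M.init x) (p.eval x.length)) ∧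
      (M.run D ch (M.init x) (p.eval x.length)).state ∈ M.accept := by
  constructor
  · rintro ⟨t, c, h, h', h''⟩
    have hr := hM.run_eq ch h
    rw [Machine.run_of_halted (hp D x t c h) (hr ▸ h'), hr]
    exact ⟨h', h''⟩
  · rintro ⟨h, h'⟩
    obtain ⟨s, -, hs, -⟩ := M.exists_steps_run (D := D) ch (M.init x) (p.eval x.length)
    exact ⟨s, _, hs, h, h'⟩

/-- The advice with the finitely many bits `α`; it is negative outside their range. -/
def advice {κ : ℕ} (α : Fin κ × Fin κ × Fin κ → Bool) (e i k : ℕ) : Prop :=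
  ∃ he hi hk, α (⟨e, he⟩, ⟨i, hi⟩, ⟨k, hk⟩) = true

/-- Membership in the language of a deterministic machine depends on few words of the generic part,
once the advice is fixed. -/
theorem exists_dependsOn_language {K Q : Type} {M : Machine K Q} (hM : M.Deterministic)
    {p : Polynomial ℕ}
    (hp : ∀ (D : Set Word) (x : Word) (t : ℕ) (c : Cfg K Q),
      M.Steps D t (M.init x) c → t ≤ p.eval x.length)
    {G O : Set Word} {a : ℕ → ℕ → ℕ → Prop} (hO : IsOracle G a O) (x : Word) {l : ℕ}
    (hl : p.eval x.length ≤ 2 ^ l) :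
    ∃ S : List Word, S.length ≤ p.eval x.length ∧ ∀ G' O', IsOracle G' a O' → Agree l G G' →
      (∀ v ∈ S, v ∈ G ↔ v ∈ G') → (x ∈ M.language O ↔ x ∈ M.language O') := by
  let ch : ℕ → Action K Q := fun _ => ⟨M.start, fun _ => none, fun _ => none, none, none⟩
  obtain ⟨S, hS, hS'⟩ := exists_dependsOn_run (G := G) (a := a) (O := O) (l := l)
    (fun q hq => hO.exists_dependsOn q (hq.trans hl)) M ch x le_rfl
  refine ⟨S, hS, fun G' O' hO' hG hv => ?_⟩
  rw [hM.mem_language_iff_run hp ch, hM.mem_language_iff_run hp ch, hS' G' O' hO' hG hv,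
    halted_iff_halted (D' := O')]

/-- A finite approximation of the generic part can be extended so that a given deterministic machine
fails to decide the set `guessSet 0 O`. For each possible advice, an input is reserved on which the
machine errs if the advice happens to be the truth. -/
theorem exists_diagonal {K Q : Type} {M : Machine K Q} (hM : M.Deterministic) (hM' : M.PolyTime)
    (l : ℕ) (G₀ : Set Word) :
    ∃ m G₁, l ≤ m ∧ Agree l G₀ G₁ ∧ ∀ G O, Agree m G G₁ → IsOracle G (Sound O) O →
      M.language O ≠ guessSet 0 O := by
  classical
  obtain ⟨p, hp⟩ := hM'
  obtain ⟨n, κ, hln, hpκ, hκ⟩ := exists_params p l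
  let Adv := Fin κ × Fin κ × Fin κ → Bool
  have hcard : Fintype.card Adv = 2 ^ κ ^ 3 := by
    simp only [Adv, Fintype.card_fun, Fintype.card_prod, Fintype.card_fin, Fintype.card_bool]
    congr 1
    ring
  obtain ⟨x⟩ : Nonempty (Adv ↪ List.Vector Bool n) := by
    refine Function.Embedding.nonempty_of_card_le ?_
    rw [hcard, card_vector, Fintype.card_bool]
    exact Nat.pow_le_pow_right (by norm_num) (by omega)
  have hx : ∀ α, (x α).1.length = n := fun α => (x α).2
  let H : Set Word := {w | w ∈ G₀ ∧ w.length ≤ l}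
  choose B hB using fun α : Adv => exists_isOracle H (advice α)
  have hpn : p.eval n ≤ 2 ^ n :=
    hpκ.le.trans (Nat.pow_le_pow_right (by norm_num) (by omega))
  choose S hS hS' using fun α : Adv =>
    exists_dependsOn_language hM hp (hB α) (x α).1 (l := n) (by rw [hx]; exact hpn)
  let W : Finset Word := Finset.univ.biUnion fun α => (S α).toFinset
  have hW : W.card < 2 ^ n := by
    calc W.card ≤ ∑ α : Adv, (S α).toFinset.card := Finset.card_biUnion_le
      _ ≤ ∑ _α : Adv, p.eval n := Finset.sum_le_sum fun α _ =>
          (List.toFinset_card_le _).trans (by have := hS α; rwa [hx] at this)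
      _ = 2 ^ κ ^ 3 * p.eval n := by simp [hcard]
      _ < 2 ^ κ ^ 3 * 2 ^ κ := Nat.mul_lt_mul_of_pos_left hpκ (by positivity)
      _ = 2 ^ (κ ^ 3 + κ) := (pow_add _ _ _).symm
      _ ≤ 2 ^ n := Nat.pow_le_pow_right (by norm_num) hκ
  -- witnesses that none of the computations considered depends on
  have hz : ∀ α, ∃ z : List.Vector Bool n, tagged 0 ((x α).1 ++ z.1) ∉ W := by
    intro α
    by_contra! hall
    have hinj : Function.Injective fun z : List.Vector Bool n => tagged 0 ((x α).1 ++ z.1) := by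
      intro z z' h
      exact Subtype.ext (List.append_cancel_left (tagged_inj.1 h).2)
    have hsub : Finset.univ.image
        (fun z : List.Vector Bool n => tagged 0 ((x α).1 ++ z.1)) ⊆ W := by
      intro w hw
      obtain ⟨z, -, rfl⟩ := Finset.mem_image.1 hw
      exact hall z
    have := Finset.card_le_card hsub
    rw [Finset.card_image_of_injective _ hinj, Finset.card_univ, card_vector,
      Fintype.card_bool] at this
    omega
  choose z hz using hz
  have hzl : ∀ α, (z α).1.length = n := fun α => (z α).2
  let N : Set Word := {w | ∃ α, (x α).1 ∉ M.language (B α) ∧ w = tagged 0 ((x α).1 ++ (z α).1)}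
  have hN : ∀ w ∈ N, w.length = 2 * n + 1 := by
    rintro _ ⟨α, -, rfl⟩
    simp [hx, hzl]
    omega
  refine ⟨max (p.eval n) (2 * n + 1), H ∪ N, le_max_of_le_right (by omega), fun w hw => ?_,
    fun G O hG hO heq => ?_⟩
  · refine ⟨fun h => Or.inl ⟨h, hw⟩, fun h => h.elim (fun h => h.1) fun h => ?_⟩
    have := hN w h
    omega
  let α : Adv := fun b => decide (Sound O b.1 b.2.1 b.2.2)
  obtain ⟨O', hO'⟩ := exists_isOracle (H ∪ N) (advice α)
  have hOO' : Agree (p.eval n) O O' := by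
    refine hO.agree hO' (hG.mono (le_max_left _ _)) fun e i k he hi hk => ?_
    have hkκ : k < κ := (Nat.pow_lt_pow_iff_right one_lt_two).1 (hk.trans hpκ)
    exact ⟨fun h => ⟨by omega, by omega, hkκ, decide_eq_true h⟩,
      fun ⟨_, _, _, h⟩ => of_decide_eq_true h⟩
  have hacc : (x α).1 ∈ M.language O ↔ (x α).1 ∈ M.language (B α) := by
    rw [hS' α (H ∪ N) O' hO']
    · exact Machine.mem_language_congr hp (by rw [hx]; exact hOO')
    · intro w hw
      refine ⟨Or.inl, fun h => h.resolve_right fun h => ?_⟩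
      have := hN w h
      omega
    · refine fun v hv => ⟨Or.inl, fun h => h.resolve_right ?_⟩
      rintro ⟨β, -, rfl⟩
      exact hz β (Finset.mem_biUnion.2 ⟨α, Finset.mem_univ _, List.mem_toFinset.2 hv⟩)
  have hmem : ∀ z : Word, z.length = n →
      (tagged 0 ((x α).1 ++ z) ∈ O ↔ tagged 0 ((x α).1 ++ z) ∈ H ∪ N) := fun z hz => by
    rw [hO.tagged_zero_mem]
    refine hG _ (le_max_of_le_right ?_)
    simp [hx, hz]
    omega
  by_cases h : (x α).1 ∈ M.language (B α)
  · have h' := hacc.2 h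
    rw [heq] at h'
    obtain ⟨y, hy, hyO⟩ := h'
    rw [hx] at hy
    rcases (hmem y hy).1 hyO with ⟨-, hlen⟩ | ⟨β, hβ, hβ'⟩
    · simp [hx] at hlen
      omega
    · have := List.append_inj_left (tagged_inj.1 hβ').2 (by rw [hx, hx])
      obtain rfl := x.injective (Subtype.ext this)
      exact hβ h
  · refine h (hacc.1 ?_)
    rw [heq]
    exact ⟨(z α).1, by rw [hx, hzl], (hmem _ (hzl α)).2 (Or.inr ⟨α, h, rfl⟩)⟩

/-- There is an oracle with truthful advice relative to which `P` differs from `NP`. -/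
theorem exists_separating_oracle :
    ∃ G O, IsOracle G (Sound O) O ∧ classP O ≠ classNP O := by
  obtain ⟨G, hG⟩ := exists_generic
    (fun i m G₁ => (idx i).M.Deterministic → ∀ G O, Agree m G G₁ → IsOracle G (Sound O) O →
      (idx i).M.language O ≠ guessSet 0 O) fun i l G₀ => by
    by_cases h : (idx i).M.Deterministic
    · obtain ⟨m, G₁, h₁, h₂, h₃⟩ := exists_diagonal h (idx i).polyTime l G₀
      exact ⟨m, G₁, h₁, h₂, fun _ => h₃⟩
    · exact ⟨l, G₀, le_rfl, fun _ _ => Iff.rfl, fun h' => (h h').elim⟩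
  obtain ⟨O, hO⟩ := exists_isOracle_sound G
  refine ⟨G, O, hO, fun heq => ?_⟩
  have hmem := guessSet_mem_classNP 0 O
  rw [← heq] at hmem
  obtain ⟨k, n, M, hdet, hM, hL⟩ := hmem
  obtain ⟨i, hi⟩ := exists_idx M hM true []
  obtain ⟨m, G₁, h₁, h₂⟩ := hG i
  rw [hi] at h₂
  exact h₂ hdet G O h₁ hO hL

theorem univ_mem_classNP (O : Set Word) : Set.univ ∈ classNP O := by
  let M : Machine (Fin 1) (Fin 1) := ⟨0, Set.univ, 0, fun _ => none, fun _ _ => ∅⟩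
  have hH : ∀ D c, M.Halted D c := fun D c => Machine.halted_iff.2 ⟨rfl, rfl⟩
  refine ⟨1, 1, M, ⟨0, fun D x t c h => ?_⟩, Set.eq_univ_of_forall fun x => ?_⟩
  · rcases Nat.eq_zero_or_pos t with rfl | ht
    · exact Nat.zero_le _
    · obtain ⟨b, b', -, h'⟩ := h.exists_prefix ht
      exact (hH D b b' h').elim
  · exact ⟨0, M.init x, .zero _, hH _ _, Set.mem_univ _⟩

end OracleTM

theorem mainTheorem2 :
    ∃ O : Set OracleTM.Word,
      OracleTM.classP O ≠ OracleTM.classNP O ∧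
      (∀ A ∈ OracleTM.classNP O ∪ OracleTM.classCoNP O,
        A.Nonempty → OracleTM.HasPOptimal O A) ∧
      ¬ (OracleTM.CON O ∨ OracleTM.SAT O) := by
  obtain ⟨G, O, hO, hPNP⟩ := OracleTM.exists_separating_oracle
  have hcomp := OracleTM.manyOneComplete_guessSet hO
  refine ⟨O, hPNP, fun A hA => hO.hasPOptimal hA, ?_⟩
  rintro (h | h)
  · refine h ⟨_, hcomp.compl, hO.hasPOptimal (Or.inr hcomp.compl.1) ⟨[], ?_⟩⟩
    rintro ⟨z, hz, hzO⟩
    obtain ⟨e, x, r, h', -⟩ := (hO.tagged_one_mem hz).1 hzO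
    simpa using congrArg List.length h'
  · obtain ⟨r, -, hr⟩ := hcomp.2 _ (OracleTM.univ_mem_classNP O)
    exact h ⟨_, hcomp, hO.hasPOptimal (Or.inl hcomp.1) ⟨r [], (hr []).1 (Set.mem_univ _)⟩⟩
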